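/- Let $AP=\{0,\dots,n-1\}$ be a finite set of atomic propositions and $\Sigma_{AP}=2^{AP}$. A timed word over $\Sigma_{AP}$ is a finite sequence of events $(\sigma_1,\tau_1)\dots(\sigma_m,\tau_m)\in(\Sigma_{AP}\times\mathbb R_{\ge 0})^*$ with $\tau_1<\dots<\tau_m$; write $t\in\rho$ if $t$ is one of the timestamps of $\rho$. Timed automata over $\Sigma_{AP}$ have finitely many locations and clocks, guards that are conjunctions of constraints $x\bowtie c$ ($c\in\mathbb N$, ${\bowtie}\in\{\le,<,\ge,>\}$), clock resets and accepting locations, and $[\![\mathcal A]\!]$ is the set of timed words on which $\mathcal A$ has an accepting run; $\mathcal A$ is untimed if all its guards are $\top$, i.e. if it is a finite automaton (which then accepts a timed word according to its sequence of letters, with arbitrary timestamps). HyperMTL formulae are given by $$\phi ::= \exists\pi\,\phi\mid\forall\pi\,\phi\mid\psi,\qquad \psi::=\top\mid\top_\pi\mid p_\pi\mid\psi_1\wedge\psi_2\mid\neg\psi\mid\psi_1\mathbin{\mathbf U_I}\psi_2\mid\psi_1\mathbin{\mathbf S_I}\psi_2,$$ with $p\in AP$, $\pi$ from an infinite supply of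 trace variables, and $I\subseteq\mathbb R_{\ge0}$ a non-singular interval with endpoints in $\mathbb N\cup\{\infty\}$; no two quantifiers of a formula use the same trace variable. A formula is closed if it has no free trace variables, and untimed if every interval $I$ in it is $[0,\infty)$. In the asynchronous semantics, for a trace set $T$, a partial map $\Pi$ from trace variables to timed words, and $t\in\mathbb R_{\ge 0}$: $(T,t)\models_\Pi\exists\pi\,\phi$ (resp. $\forall\pi\,\phi$) iff $(T,t)\models_{\Pi[\pi\mapsto\rho]}\phi$ for some (resp. every) $\rho\in T$; $\top$ holds at $t$ iff $t\in\rho$ for some $\rho$ in the range of $\Pi$; $\top_\pi$ holds at $t$ iff $t\in\Pi(\pi)$; $p_\pi$ holds at $t$ iff $\Pi(\pi)$ has an event $(\sigma,t)$ with $p\in\sigma$; $\wedge$ is conjunction; $\psi_1\mathbin{\mathbf U_I}\psi_2$ holds at $t$ iff there is $t'>t$ with $t'-t\in I$ such that $\top$ and $\psi_2$ hold at $t'$ and $\psi_1$ holds at every $t''\in(t,t')$ at which $\top$ holds; $\psi_1\mathbin{\mathbf S_I}\psi_2$ is the mirror image, with $0\le t'<t$ and $t-t'\in I$. Negation is evaluated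 by pushing it to the atoms, through the De Morgan law and the duals of $\mathbf U_I$ and $\mathbf S_I$, where in the duals, too, only times at which $\top$ holds count; $\neg\top$ and $\neg\top_\pi$ are the complements of $\top$ and $\top_\pi$, and $\neg p_\pi$ holds at $t$ iff $\Pi(\pi)$ has an event $(\sigma,t)$ with $p\notin\sigma$. Finally, $T\models\phi$ for closed $\phi$ iff $(T,0)\models_{\Pi_\emptyset}\phi$, where $\Pi_\emptyset$ is the empty assignment. **Proposition.** Model checking HyperMTL in the asynchronous semantics, with arbitrary quantifier alternation, is decidable when the model and the specification are both untimed: there is an algorithm (a computable function on standard encodings of the inputs by finite data) which, given $n$, an untimed timed automaton (that is, a finite automaton) $\mathcal A$ over $\Sigma_{AP}$, $AP=\{0,\dots,n-1\}$, and an untimed closed HyperMTL formula $\phi$ over $AP$, decides whether $[\![\mathcal A]\!]\models\phi$. -/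

import Mathlib

open scoped NNReal

namespace TimedHyper

/-! ### Timed words -/

/-- A timed word over `α`: a finite sequence of events with strictly increasing timestamps. -/
structure TimedWord (α : Type) where
  events : List (α × ℝ≥0)
  increasing : events.Pairwise (fun e f => e.2 < f.2)

/-- `ρ.HasTime t` is `t ∈ ρ`: some event of `ρ` happens at time `t`. -/
def TimedWord.HasTime {α : Type} (ρ : TimedWord α) (t : ℝ≥0) : Prop :=
  ∃ σ, (σ, t) ∈ ρ.events

/-- The alphabet `2 ^ AP` for the set `AP = {0, …, n - 1}` of atomic propositions. -/
abbrev Letter (n : ℕ) : Type := Finset (Fin n)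

/-! ### Timed automata -/

inductive Cmp
  | le | lt | ge | gt

def Cmp.Holds : Cmp → ℝ≥0 → ℝ≥0 → Prop
  | .le, a, b => a ≤ b
  | .lt, a, b => a < b
  | .ge, a, b => a ≥ b
  | .gt, a, b => a > b

/-- A guard is a finite conjunction of constraints `x ⋈ c`; the empty list is the guard `⊤`. -/
abbrev Guard (X : Type) : Type := List (X × Cmp × ℕ)

def Guard.Holds {X : Type} (g : Guard X) (v : X → ℝ≥0) : Prop :=
  ∀ c ∈ g, c.2.1.Holds (v c.1) (c.2.2 : ℝ≥0)

structure Transition (α S X : Type) where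
  src : S
  letter : α
  guard : Guard X
  reset : Finset X
  dst : S

/-- A timed automaton over `α` with locations `{0, …, numLoc - 1}` and clocks
`{0, …, numClk - 1}`; its finite transition relation is given by a list. -/
structure TimedAutomaton (α : Type) where
  numLoc : ℕ
  numClk : ℕ
  start : Fin numLoc
  trans : List (Transition α (Fin numLoc) (Fin numClk))
  accept : Finset (Fin numLoc)

/-- `A.AcceptsFrom s v τ w`: from location `s` with clock valuation `v` at time `τ` there is a
run on the remaining events `w` that ends in an accepting location. -/
def TimedAutomaton.AcceptsFrom {α : Type} (A : TimedAutomaton α) :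
    Fin A.numLoc → (Fin A.numClk → ℝ≥0) → ℝ≥0 → List (α × ℝ≥0) → Prop
  | s, _, _, [] => s ∈ A.accept
  | s, v, τ, (σ, τ') :: w =>
      ∃ e ∈ A.trans, e.src = s ∧ e.letter = σ ∧
        e.guard.Holds (fun x => v x + (τ' - τ)) ∧
        A.AcceptsFrom e.dst (fun x => if x ∈ e.reset then 0 else v x + (τ' - τ)) τ' w

/-- The timed language of `A`. -/
def TimedAutomaton.language {α : Type} (A : TimedAutomaton α) : Set (TimedWord α) :=
  {ρ | A.AcceptsFrom A.start (fun _ => 0) 0 ρ.events}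

/-- A model is untimed if it has no clock constraints (in particular if it has no clocks), i.e.
if it is a finite automaton. -/
def TimedAutomaton.Untimed {α : Type} (A : TimedAutomaton α) : Prop :=
  ∀ e ∈ A.trans, e.guard = []

/-! ### Formulae -/

/-- A non-singular interval with endpoints in `ℕ ∪ {∞}`: the left endpoint `lo` belongs to the
interval iff `loClosed`; the right endpoint is `∞` if `hi = none`, and it is `b` if
`hi = some (b, c)`, in which case it belongs to the interval iff `c`. -/
structure Interval where
  lo : ℕ
  loClosed : Bool
  hi : Option (ℕ × Bool)
  nonsingular : ∀ b ∈ hi, lo < b.1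

def Interval.Mem (I : Interval) (d : ℝ≥0) : Prop :=
  (if I.loClosed then (I.lo : ℝ≥0) ≤ d else (I.lo : ℝ≥0) < d) ∧
    ∀ b ∈ I.hi, if b.2 then d ≤ (b.1 : ℝ≥0) else d < (b.1 : ℝ≥0)

/-- The interval is `[0, ∞)`. -/
def Interval.IsTrivial (I : Interval) : Prop :=
  I.lo = 0 ∧ I.loClosed = true ∧ I.hi = none

/-- Quantifier-free HyperMTL formulae over `AP = Fin n`; trace variables are natural numbers. -/
inductive QFree (n : ℕ)
  | top : QFree n
  | topOf (π : ℕ) : QFree n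
  | prop (p : Fin n) (π : ℕ) : QFree n
  | and (a b : QFree n) : QFree n
  | neg (a : QFree n) : QFree n
  | untl (I : Interval) (a b : QFree n) : QFree n
  | snce (I : Interval) (a b : QFree n) : QFree n

/-- HyperMTL formulae. -/
inductive HyperMTL (n : ℕ)
  | ex (π : ℕ) (φ : HyperMTL n) : HyperMTL n
  | all (π : ℕ) (φ : HyperMTL n) : HyperMTL n
  | qfree (ψ : QFree n) : HyperMTL n

def QFree.vars {n : ℕ} : QFree n → Finset ℕ
  | .top => ∅
  | .topOf π => {π}
  | .prop _ π => {π}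
  | .and a b => a.vars ∪ b.vars
  | .neg a => a.vars
  | .untl _ a b => a.vars ∪ b.vars
  | .snce _ a b => a.vars ∪ b.vars

def HyperMTL.freeVars {n : ℕ} : HyperMTL n → Finset ℕ
  | .ex π φ => φ.freeVars.erase π
  | .all π φ => φ.freeVars.erase π
  | .qfree ψ => ψ.vars

def HyperMTL.quantified {n : ℕ} : HyperMTL n → List ℕ
  | .ex π φ => π :: φ.quantified
  | .all π φ => π :: φ.quantified
  | .qfree _ => []

def HyperMTL.Closed {n : ℕ} (φ : HyperMTL n) : Prop :=
  φ.freeVars = ∅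

/-- Every trace quantifier uses a fresh trace variable. -/
def HyperMTL.NoReuse {n : ℕ} (φ : HyperMTL n) : Prop :=
  φ.quantified.Nodup

def QFree.Untimed {n : ℕ} : QFree n → Prop
  | .top => True
  | .topOf _ => True
  | .prop _ _ => True
  | .and a b => a.Untimed ∧ b.Untimed
  | .neg a => a.Untimed
  | .untl I a b => I.IsTrivial ∧ a.Untimed ∧ b.Untimed
  | .snce I a b => I.IsTrivial ∧ a.Untimed ∧ b.Untimed

/-- A formula is untimed if all its constraining intervals are `[0, ∞)`. -/
def HyperMTL.Untimed {n : ℕ} : HyperMTL n → Prop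
  | .ex _ φ => φ.Untimed
  | .all _ φ => φ.Untimed
  | .qfree ψ => ψ.Untimed

/-! ### Negation normal form -/

/-- Quantifier-free formulae in negation normal form. The constructors `dualUntl` and `dualSnce`
are the duals of until and since. -/
inductive NNF (n : ℕ)
  | top : NNF n
  | bot : NNF n
  | topOf (π : ℕ) : NNF n
  | botOf (π : ℕ) : NNF n
  | prop (p : Fin n) (π : ℕ) : NNF n
  | negProp (p : Fin n) (π : ℕ) : NNF n
  | and (a b : NNF n) : NNF n
  | or (a b : NNF n) : NNF n
  | untl (I : Interval) (a b : NNF n) : NNF n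
  | dualUntl (I : Interval) (a b : NNF n) : NNF n
  | snce (I : Interval) (a b : NNF n) : NNF n
  | dualSnce (I : Interval) (a b : NNF n) : NNF n

/-- `ψ.nnf true` is the negation normal form of `ψ`, `ψ.nnf false` that of its negation. -/
def QFree.nnf {n : ℕ} : QFree n → Bool → NNF n
  | .top, true => .top
  | .top, false => .bot
  | .topOf π, true => .topOf π
  | .topOf π, false => .botOf π
  | .prop p π, true => .prop p π
  | .prop p π, false => .negProp p π
  | .and a b, true => .and (a.nnf true) (b.nnf true)
  | .and a b, false => .or (a.nnf false) (b.nnf false)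
  | .neg a, true => a.nnf false
  | .neg a, false => a.nnf true
  | .untl I a b, true => .untl I (a.nnf true) (b.nnf true)
  | .untl I a b, false => .dualUntl I (a.nnf false) (b.nnf false)
  | .snce I a b, true => .snce I (a.nnf true) (b.nnf true)
  | .snce I a b, false => .dualSnce I (a.nnf false) (b.nnf false)

/-! ### Asynchronous semantics -/

/-- A trace assignment: a partial map from trace variables to timed words. -/
abbrev Assignment (n : ℕ) : Type := ℕ → Option (TimedWord (Letter n))

/-- Some trace in the range of `P` has an event at time `t`. -/
def Assignment.HasTime {n : ℕ} (P : Assignment n) (t : ℝ≥0) : Prop :=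
  ∃ π, ∃ ρ ∈ P π, ρ.HasTime t

def NNF.Sat {n : ℕ} (P : Assignment n) : NNF n → ℝ≥0 → Prop
  | .top, t => P.HasTime t
  | .bot, t => ¬ P.HasTime t
  | .topOf π, t => ∃ ρ ∈ P π, ρ.HasTime t
  | .botOf π, t => ¬ ∃ ρ ∈ P π, ρ.HasTime t
  | .prop p π, t => ∃ ρ ∈ P π, ∃ σ, (σ, t) ∈ ρ.events ∧ p ∈ σ
  | .negProp p π, t => ∃ ρ ∈ P π, ∃ σ, (σ, t) ∈ ρ.events ∧ p ∉ σ
  | .and a b, t => a.Sat P t ∧ b.Sat P t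
  | .or a b, t => a.Sat P t ∨ b.Sat P t
  | .untl I a b, t => ∃ t', t < t' ∧ I.Mem (t' - t) ∧ P.HasTime t' ∧ b.Sat P t' ∧
      ∀ t'', t < t'' → t'' < t' → P.HasTime t'' → a.Sat P t''
  | .dualUntl I a b, t => ∀ t', t < t' → I.Mem (t' - t) → P.HasTime t' → b.Sat P t' ∨
      ∃ t'', t < t'' ∧ t'' < t' ∧ P.HasTime t'' ∧ a.Sat P t''
  | .snce I a b, t => ∃ t', t' < t ∧ I.Mem (t - t') ∧ P.HasTime t' ∧ b.Sat P t' ∧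
      ∀ t'', t' < t'' → t'' < t → P.HasTime t'' → a.Sat P t''
  | .dualSnce I a b, t => ∀ t', t' < t → I.Mem (t - t') → P.HasTime t' → b.Sat P t' ∨
      ∃ t'', t' < t'' ∧ t'' < t ∧ P.HasTime t'' ∧ a.Sat P t''

def HyperMTL.Sat {n : ℕ} (T : Set (TimedWord (Letter n))) :
    HyperMTL n → Assignment n → ℝ≥0 → Prop
  | .ex π φ, P, t => ∃ ρ ∈ T, φ.Sat T (Function.update P π (some ρ)) t
  | .all π φ, P, t => ∀ ρ ∈ T, φ.Sat T (Function.update P π (some ρ)) t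
  | .qfree ψ, P, t => (ψ.nnf true).Sat P t

/-- The trace set `T` satisfies `φ` in the asynchronous semantics. -/
def Satisfies {n : ℕ} (T : Set (TimedWord (Letter n))) (φ : HyperMTL n) : Prop :=
  φ.Sat T (fun _ => none) 0

/-! ### Encoding of the inputs by finite data -/

/-- A set of numbers below `n` is presented by its increasing list of elements. -/
def finsetCode {n : ℕ} (s : Finset (Fin n)) : List ℕ :=
  ((List.finRange n).filter (fun i => i ∈ s)).map Fin.val

def Cmp.code : Cmp → ℕ
  | .le => 0
  | .lt => 1
  | .ge => 2
  | .gt => 3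

/-- Source, letter, guard, clocks to be reset, target. -/
abbrev TransitionCode : Type := ℕ × List ℕ × List (ℕ × ℕ × ℕ) × List ℕ × ℕ

def Transition.code {n m k : ℕ} (e : Transition (Letter n) (Fin m) (Fin k)) : TransitionCode :=
  (e.src.val, finsetCode e.letter, e.guard.map (fun c => (c.1.val, c.2.1.code, c.2.2)),
    finsetCode e.reset, e.dst.val)

/-- Number of locations, number of clocks, initial location, transitions, accepting locations. -/
abbrev AutomatonCode : Type := ℕ × ℕ × ℕ × List TransitionCode × List ℕ

def TimedAutomaton.code {n : ℕ} (A : TimedAutomaton (Letter n)) : AutomatonCode :=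
  (A.numLoc, A.numClk, A.start.val, A.trans.map Transition.code, finsetCode A.accept)

def Interval.code (I : Interval) : ℕ :=
  Encodable.encode (I.lo, I.loClosed, I.hi)

/-- Gödel numbers of quantifier-free formulae, by the pairing function `Nat.pair`. -/
def QFree.code {n : ℕ} : QFree n → ℕ
  | .top => Nat.pair 0 0
  | .topOf π => Nat.pair 1 π
  | .prop p π => Nat.pair 2 (Nat.pair p.val π)
  | .and a b => Nat.pair 3 (Nat.pair a.code b.code)
  | .neg a => Nat.pair 4 a.code
  | .untl I a b => Nat.pair 5 (Nat.pair I.code (Nat.pair a.code b.code))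
  | .snce I a b => Nat.pair 6 (Nat.pair I.code (Nat.pair a.code b.code))

/-- The quantifier prefix (`true` for an existential quantifier) and the code of the
quantifier-free part. -/
abbrev FormulaCode : Type := List (Bool × ℕ) × ℕ

def HyperMTL.code {n : ℕ} : HyperMTL n → FormulaCode
  | .ex π φ => ((true, π) :: φ.code.1, φ.code.2)
  | .all π φ => ((false, π) :: φ.code.1, φ.code.2)
  | .qfree ψ => ([], ψ.code)

end TimedHyper

namespace TimedHyper

/-! When all intervals are `[0, ∞)`, the asynchronous semantics sees timestamps only through their
order. Finitely many traces can therefore be merged into one word of columns, with one column for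
each time at which some trace has an event, and a first column for time `0`, where evaluation starts
and which may be empty. Assigning a further trace means adding events to existing columns and
inserting fresh columns anywhere except in front (`Insertion`). Conversely, every such insertion
comes from a trace: the reals are dense, so fresh times fit between any two given ones, and
unbounded, so they fit after the last one. An untimed automaton accepts a trace by its letters
alone, so `Satisfies` turns into the purely discrete `HyperMTL.Holds`
(`Assignment.Represents.hyperMTL_sat_iff`).

What remains infinite is the number of fresh columns. The set of words satisfying `HyperMTL.Holds`
is regular, with a number of states bounded by a computable function of the input
(`HyperMTL.recognizable_holds`): quantifier-free formulae are handled by `QFree.twoSided_holds`, a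
quantifier by a product and a powerset construction (`Recognizable.exists_insertion`). The alphabet
of columns is infinite, but only the number of states matters. By pumping, a block of fresh columns
longer than the number of states can be shortened without changing the state reached, so each
quantifier may be restricted to the finite list `insertions` (`Recognizable.exists_insertion_iff`).

The decision procedure `evalPrefix` is then a brute-force evaluation. It never builds the automata;
it uses only the bound on their size. It is primitive recursive (`primrec_evalPrefix`), hence
computable. -/

/-- The events of several traces at one time: pairs of a trace variable and the code of its
letter. -/
abbrev Column : Type := List (ℕ × List ℕ)

/-! ### Languages of columns recognized by automata of bounded size -/

/-- The set of words `L` is accepted by a deterministic automaton with at most `N` states. -/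
def Recognizable {α : Type} (L : List α → Prop) (N : ℕ) : Prop :=
  ∃ (σ : Type) (_ : Fintype σ) (D : DFA α σ), Fintype.card σ ≤ N ∧ ∀ w, D.eval w ∈ D.accept ↔ L w

theorem Recognizable.mono {α : Type} {L : List α → Prop} {N M : ℕ} (h : Recognizable L N)
    (hNM : N ≤ M) : Recognizable L M := by
  obtain ⟨σ, i, D, hD, hL⟩ := h
  exact ⟨σ, i, D, hD.trans hNM, hL⟩

theorem Recognizable.congr {α : Type} {L L' : List α → Prop} {N : ℕ} (h : Recognizable L N)
    (hLL : ∀ w, L w ↔ L' w) : Recognizable L' N := by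
  obtain ⟨σ, i, D, hD, hL⟩ := h
  exact ⟨σ, i, D, hD, fun w => (hL w).trans (hLL w)⟩

theorem Recognizable.not {α : Type} {L : List α → Prop} {N : ℕ} (h : Recognizable L N) :
    Recognizable (fun w => ¬ L w) N := by
  obtain ⟨σ, i, D, hD, hL⟩ := h
  exact ⟨σ, i, Dᶜ, hD, fun w => not_congr (hL w)⟩

theorem Recognizable.and {α : Type} {L L' : List α → Prop} {N N' : ℕ} (h : Recognizable L N)
    (h' : Recognizable L' N') : Recognizable (fun w => L w ∧ L' w) (N * N') := by
  obtain ⟨σ, i, D, hD, hL⟩ := h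
  obtain ⟨σ', i', D', hD', hL'⟩ := h'
  refine ⟨σ × σ', inferInstance, D.inter D', ?_, fun w => ?_⟩
  · rw [Fintype.card_prod]
    exact Nat.mul_le_mul hD hD'
  · have h := congrArg (fun K : Language α => w ∈ K) (DFA.accepts_inter D D')
    simp only [eq_iff_iff] at h
    exact h.trans (and_congr (hL w) (hL' w))

/-- The letters of the variable `π` in a word of columns. -/
def letters (π : ℕ) (w : List Column) : List (List ℕ) :=
  (w.flatten.filter (fun e => e.1 = π)).map Prod.snd

theorem letters_append (π : ℕ) (w z : List Column) :
    letters π (w ++ z) = letters π w ++ letters π z := by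
  simp [letters]

theorem letters_cons (π : ℕ) (c : Column) (w : List Column) :
    letters π (c :: w) = letters π [c] ++ letters π w :=
  letters_append π [c] w

/-- Preimage under a monoid homomorphism: on reading a column, the automaton makes all the moves for
the letters of `π` in it, possibly none, so the states stay the same. -/
theorem Recognizable.letters {L : List (List ℕ) → Prop} {N : ℕ} (h : Recognizable L N) (π : ℕ) :
    Recognizable (fun w => L (letters π w)) N := by
  obtain ⟨σ, i, D, hD, hL⟩ := h
  let E : DFA Column σ := ⟨fun s c => D.evalFrom s (TimedHyper.letters π [c]), D.start, D.accept⟩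
  have key : ∀ w s, E.evalFrom s w = D.evalFrom s (TimedHyper.letters π w) := by
    intro w
    induction w with
    | nil => intro s; rfl
    | cons c w ih =>
      intro s
      rw [letters_cons, DFA.evalFrom_of_append, DFA.evalFrom_cons, ih]
  refine ⟨σ, i, E, hD, fun w => ?_⟩
  refine Iff.trans ?_ (hL _)
  rw [DFA.eval, key]
  rfl

/-! ### Inserting the events of a trace -/

/-- `d` consists of a single event of `π`, with a letter from `alph`. -/
def IsFresh (π : ℕ) (alph : List (List ℕ)) (d : Column) : Prop :=
  ∃ σ ∈ alph, d = [(π, σ)]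

/-- `c'` is `c`, possibly with an event of `π` added. -/
def IsUpdate (π : ℕ) (alph : List (List ℕ)) (c c' : Column) : Prop :=
  c' = c ∨ ∃ σ ∈ alph, c' = (π, σ) :: c

/-- The second word arises from the first one by adding events of `π` to columns and by inserting
fresh columns, but none in front. -/
def Insertion (π : ℕ) (alph : List (List ℕ)) : List Column → List Column → Prop
  | [], z => z = []
  | c :: w, z => ∃ c' v w', IsUpdate π alph c c' ∧ (∀ d ∈ v, IsFresh π alph d) ∧
      Insertion π alph w w' ∧ z = c' :: (v ++ w')

/-- The words of at most `B` fresh columns. -/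
def gaps (π : ℕ) (alph : List (List ℕ)) : ℕ → List (List Column)
  | 0 => [[]]
  | B + 1 => [] :: alph.flatMap fun σ => (gaps π alph B).map fun v => [(π, σ)] :: v

/-- The insertions with at most `B` fresh columns after each column. -/
def insertions (π : ℕ) (alph : List (List ℕ)) (B : ℕ) : List Column → List (List Column)
  | [] => [[]]
  | c :: w => (c :: alph.map fun σ => (π, σ) :: c).flatMap fun c' =>
      (gaps π alph B).flatMap fun v => (insertions π alph B w).map fun w' => c' :: (v ++ w')

theorem mem_gaps {π : ℕ} {alph : List (List ℕ)} {B : ℕ} {v : List Column} :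
    v ∈ gaps π alph B ↔ v.length ≤ B ∧ ∀ d ∈ v, IsFresh π alph d := by
  induction B generalizing v with
  | zero =>
    cases v <;> simp [gaps]
  | succ B ih =>
    cases v with
    | nil => simp [gaps]
    | cons d v =>
      simp only [gaps, List.mem_cons, List.mem_flatMap, List.mem_map, ih, reduceCtorEq, false_or,
        List.cons.injEq, List.length_cons, Nat.add_le_add_iff_right, forall_eq_or_imp, IsFresh]
      constructor
      · rintro ⟨σ, hσ, v', ⟨h1, h2⟩, rfl, rfl⟩
        exact ⟨h1, ⟨σ, hσ, rfl⟩, h2⟩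
      · rintro ⟨h1, ⟨σ, hσ, rfl⟩, h2⟩
        exact ⟨σ, hσ, v, ⟨h1, h2⟩, rfl, rfl⟩

theorem mem_insertions_cons {π : ℕ} {alph : List (List ℕ)} {B : ℕ} {c : Column}
    {w z : List Column} : z ∈ insertions π alph B (c :: w) ↔
      ∃ c' v w', IsUpdate π alph c c' ∧ (v.length ≤ B ∧ ∀ d ∈ v, IsFresh π alph d) ∧
        w' ∈ insertions π alph B w ∧ z = c' :: (v ++ w') := by
  simp only [insertions, List.mem_flatMap, List.mem_map, mem_gaps, List.mem_cons, IsUpdate]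
  constructor
  · rintro ⟨c', hc, v, hv, w', hw, rfl⟩
    exact ⟨c', v, w', hc.imp id fun ⟨σ, h, e⟩ => ⟨σ, h, e.symm⟩, hv, hw, rfl⟩
  · rintro ⟨c', v, w', hc, hv, hw, rfl⟩
    exact ⟨c', hc.imp id fun ⟨σ, h, e⟩ => ⟨σ, h, e.symm⟩, v, hv, w', hw, rfl⟩

theorem insertion_of_mem_insertions {π : ℕ} {alph : List (List ℕ)} {B : ℕ} {w z : List Column}
    (h : z ∈ insertions π alph B w) : Insertion π alph w z := by
  induction w generalizing z with
  | nil => simpa [insertions, Insertion] using h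
  | cons c w ih =>
    obtain ⟨c', v, w', hc, hv, hw, rfl⟩ := mem_insertions_cons.1 h
    exact ⟨c', v, w', hc, hv.2, ih hw, rfl⟩

/-- Pumping down: a longer word visits some state twice, and the loop between the visits can be cut
out. Deleting letters preserves the condition `F` on each letter. -/
theorem exists_short_word {α σ : Type} [Fintype σ] (D : DFA α σ) (F : α → Prop) (s : σ)
    (v : List α) (hv : ∀ d ∈ v, F d) :
    ∃ v', v'.length ≤ Fintype.card σ ∧ (∀ d ∈ v', F d) ∧ D.evalFrom s v' = D.evalFrom s v := by
  induction hn : v.length using Nat.strong_induction_on generalizing v with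
  | _ m ih =>
    by_cases hl : v.length ≤ Fintype.card σ
    · exact ⟨v, hl, hv, rfl⟩
    · obtain ⟨q, a, b, c, rfl, -, hb, ha, hq, hc⟩ :=
        D.evalFrom_split (s := s) (x := v) (by omega) rfl
      have hbl : 0 < b.length := List.length_pos_iff.2 hb
      obtain ⟨v', h1, h2, h3⟩ := ih (a ++ c).length (by simp at hn ⊢; omega) (a ++ c)
        (fun d hd => hv d (by simp at hd ⊢; tauto)) rfl
      refine ⟨v', h1, h2, h3.trans ?_⟩
      rw [← hc, DFA.evalFrom_of_append, ha]

/-- Each block of fresh columns is shortened on its own. Since the state at its end is unchanged,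
the rest of the word can be treated from that same state; this is why `s` is arbitrary. -/
theorem exists_mem_insertions {π : ℕ} {alph : List (List ℕ)} {B : ℕ} {σ : Type} [Fintype σ]
    (D : DFA Column σ) (hB : Fintype.card σ ≤ B) {w z : List Column} (h : Insertion π alph w z)
    (s : σ) : ∃ z' ∈ insertions π alph B w, D.evalFrom s z' = D.evalFrom s z := by
  induction w generalizing z s with
  | nil => exact ⟨[], by simp [insertions], by rw [show z = [] from h]⟩
  | cons c w ih =>
    obtain ⟨c', v, w', hc, hv, hw, rfl⟩ := h
    obtain ⟨v', h1, h2, h3⟩ := exists_short_word D (IsFresh π alph) (D.step s c') v hv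
    obtain ⟨z', h4, h5⟩ := ih hw (D.evalFrom (D.step s c') v)
    refine ⟨c' :: (v' ++ z'),
      mem_insertions_cons.2 ⟨c', v', z', hc, ⟨h1.trans hB, h2⟩, h4, rfl⟩, ?_⟩
    rw [DFA.evalFrom_cons, DFA.evalFrom_cons, DFA.evalFrom_of_append, DFA.evalFrom_of_append, h3,
      h5]

/-- This makes the quantifiers finite: a search through a list replaces one over words of unbounded
length. -/
theorem Recognizable.exists_insertion_iff {L : List Column → Prop} {N : ℕ}
    (h : Recognizable L N) (π : ℕ) (alph : List (List ℕ)) (w : List Column) :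
    (∃ z ∈ insertions π alph N w, L z) ↔ ∃ z, Insertion π alph w z ∧ L z := by
  constructor
  · rintro ⟨z, hz, hL⟩
    exact ⟨z, insertion_of_mem_insertions hz, hL⟩
  · rintro ⟨z, hz, hLz⟩
    obtain ⟨σ, i, D, hD, hL⟩ := h
    obtain ⟨z', h1, h2⟩ := exists_mem_insertions D hD hz D.start
    refine ⟨z', h1, (hL z').1 ?_⟩
    rw [DFA.eval, h2]
    exact (hL z).2 hLz

/-- Powerset construction for a projection. An insertion into `c :: w` is an insertion into `[c]`
followed by one into `w`, so a single input column takes a state to all states reachable along the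
whole block that may replace it, however long. -/
theorem Recognizable.exists_insertion {L : List Column → Prop} {N : ℕ} (h : Recognizable L N)
    (π : ℕ) (alph : List (List ℕ)) :
    Recognizable (fun w => ∃ z, Insertion π alph w z ∧ L z) (2 ^ N) := by
  obtain ⟨σ, i, D, hD, hL⟩ := h
  let E : DFA Column (Set σ) :=
    ⟨fun S c => {t | ∃ s ∈ S, ∃ v, Insertion π alph [c] v ∧ D.evalFrom s v = t}, {D.start},
      {S | ∃ s ∈ S, s ∈ D.accept}⟩
  have key : ∀ w (S : Set σ) t, t ∈ E.evalFrom S w ↔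
      ∃ s ∈ S, ∃ z, Insertion π alph w z ∧ D.evalFrom s z = t := by
    intro w
    induction w with
    | nil => intro S t; simp [Insertion]
    | cons c w ih =>
      intro S t
      rw [DFA.evalFrom_cons, ih]
      constructor
      · rintro ⟨_, ⟨s, hs, _, ⟨c', v, _, hc, hv, rfl, rfl⟩, rfl⟩, z, hz, rfl⟩
        refine ⟨s, hs, c' :: (v ++ z), ⟨c', v, z, hc, hv, hz, rfl⟩, ?_⟩
        rw [List.append_nil, ← DFA.evalFrom_of_append, List.cons_append]
      · rintro ⟨s, hs, _, ⟨c', v, z, hc, hv, hz, rfl⟩, rfl⟩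
        refine ⟨_, ⟨s, hs, c' :: v, ⟨c', v, [], hc, hv, rfl, by simp⟩, rfl⟩, z, hz, ?_⟩
        rw [← DFA.evalFrom_of_append, List.cons_append]
  classical
  refine ⟨Set σ, inferInstance, E, ?_, fun w => ?_⟩
  · rw [Fintype.card_set]
    exact Nat.pow_le_pow_right (by norm_num) hD
  · constructor
    · rintro ⟨t, ht, hacc⟩
      obtain ⟨s, rfl, z, hz, rfl⟩ := (key w _ t).1 ht
      exact ⟨z, hz, (hL z).1 hacc⟩
    · rintro ⟨z, hz, hLz⟩
      exact ⟨_, (key w _ _).2 ⟨D.start, rfl, z, hz, rfl⟩, (hL z).2 hLz⟩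

/-! ### Runs on sequences of letters -/

/-- From location `s` there is an accepting run, with guards ignored, on the letters with the
given codes. -/
def TimedAutomaton.CodeRun {n : ℕ} (A : TimedAutomaton (Letter n)) :
    Fin A.numLoc → List (List ℕ) → Prop
  | s, [] => s ∈ A.accept
  | s, l :: u => ∃ e ∈ A.trans, e.src = s ∧ finsetCode e.letter = l ∧ A.CodeRun e.dst u

/-- The subset construction for the finite automaton that remains when guards and clocks are
dropped. -/
theorem TimedAutomaton.recognizable_codeRun {n : ℕ} (A : TimedAutomaton (Letter n)) :
    Recognizable (A.CodeRun A.start) (2 ^ A.numLoc) := by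
  let E : DFA (List ℕ) (Set (Fin A.numLoc)) :=
    ⟨fun S l => {t | ∃ e ∈ A.trans, e.src ∈ S ∧ finsetCode e.letter = l ∧ e.dst = t}, {A.start},
      {S | ∃ s ∈ S, s ∈ A.accept}⟩
  have key : ∀ u (S : Set (Fin A.numLoc)),
      E.evalFrom S u ∈ E.accept ↔ ∃ s ∈ S, A.CodeRun s u := by
    intro u
    induction u with
    | nil => intro S; rfl
    | cons l u ih =>
      intro S
      rw [DFA.evalFrom_cons, ih]
      constructor
      · rintro ⟨_, ⟨e, he, hs, hl, rfl⟩, hr⟩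
        exact ⟨_, hs, e, he, rfl, hl, hr⟩
      · rintro ⟨_, hs, e, he, rfl, hl, hr⟩
        exact ⟨_, ⟨e, he, hs, hl, rfl⟩, hr⟩
  classical
  refine ⟨Set (Fin A.numLoc), inferInstance, E, by simp, fun u => (key u _).trans ?_⟩
  exact ⟨fun ⟨_, h, hr⟩ => h ▸ hr, fun hr => ⟨_, rfl, hr⟩⟩

theorem finsetCode_injective {n : ℕ} : Function.Injective (finsetCode (n := n)) := by
  intro s t h
  ext i
  have := congrArg (i.val ∈ ·) h
  simpa [finsetCode, ← Fin.ext_iff] using this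

theorem mem_finsetCode {n : ℕ} {s : Finset (Fin n)} {i : Fin n} : i.val ∈ finsetCode s ↔ i ∈ s := by
  simp [finsetCode, ← Fin.ext_iff]

theorem TimedAutomaton.Untimed.acceptsFrom_iff {n : ℕ} {A : TimedAutomaton (Letter n)}
    (hA : A.Untimed) (s : Fin A.numLoc) (v : Fin A.numClk → ℝ≥0) (τ : ℝ≥0)
    (w : List (Letter n × ℝ≥0)) :
    A.AcceptsFrom s v τ w ↔ A.CodeRun s (w.map fun e => finsetCode e.1) := by
  induction w generalizing s v τ with
  | nil => rfl
  | cons e w ih =>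
    obtain ⟨σ, τ'⟩ := e
    simp only [TimedAutomaton.AcceptsFrom, List.map_cons, TimedAutomaton.CodeRun, ih]
    refine exists_congr fun e => and_congr_right fun he => and_congr_right fun _ => ?_
    rw [finsetCode_injective.eq_iff, hA e he]
    simp [Guard.Holds]

/-! ### Semantics on words of columns -/

/-- Satisfaction at position `i` of a word of columns; intervals are ignored, and only positions
with a nonempty column count as times. -/
def NNF.Holds {n : ℕ} (w : List Column) : NNF n → ℕ → Prop
  | .top, i => w.getD i [] ≠ []
  | .bot, i => w.getD i [] = []
  | .topOf π, i => ∃ l, (π, l) ∈ w.getD i []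
  | .botOf π, i => ¬ ∃ l, (π, l) ∈ w.getD i []
  | .prop p π, i => ∃ l, (π, l) ∈ w.getD i [] ∧ p.val ∈ l
  | .negProp p π, i => ∃ l, (π, l) ∈ w.getD i [] ∧ p.val ∉ l
  | .and a b, i => a.Holds w i ∧ b.Holds w i
  | .or a b, i => a.Holds w i ∨ b.Holds w i
  | .untl _ a b, i => ∃ j, i < j ∧ w.getD j [] ≠ [] ∧ b.Holds w j ∧
      ∀ k, i < k → k < j → w.getD k [] ≠ [] → a.Holds w k
  | .dualUntl _ a b, i => ∀ j, i < j → w.getD j [] ≠ [] → b.Holds w j ∨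
      ∃ k, i < k ∧ k < j ∧ w.getD k [] ≠ [] ∧ a.Holds w k
  | .snce _ a b, i => ∃ j, j < i ∧ w.getD j [] ≠ [] ∧ b.Holds w j ∧
      ∀ k, j < k → k < i → w.getD k [] ≠ [] → a.Holds w k
  | .dualSnce _ a b, i => ∀ j, j < i → w.getD j [] ≠ [] → b.Holds w j ∨
      ∃ k, j < k ∧ k < i ∧ w.getD k [] ≠ [] ∧ a.Holds w k

/-! ### Properties of positions recognized from both sides -/

/-- The truth of `p` at a position depends only on the column there, on the state in which an
automaton arrives from the left, and on the state in which one arrives from the right; both have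
at most `N` states. -/
def TwoSided (p : List Column → ℕ → Prop) (N : ℕ) : Prop :=
  ∃ (L R : Type) (_ : Fintype L) (_ : Fintype R) (f : L → Column → L) (l₀ : L)
    (g : Column → R → R) (r₀ : R) (acc : L → Column → R → Prop),
    Fintype.card L ≤ N ∧ Fintype.card R ≤ N ∧
    ∀ x c y, p (x ++ c :: y) x.length ↔ acc (x.foldl f l₀) c (y.foldr g r₀)

theorem TwoSided.mono {p : List Column → ℕ → Prop} {N M : ℕ} (h : TwoSided p N) (hNM : N ≤ M) :
    TwoSided p M := by
  obtain ⟨L, R, iL, iR, f, l₀, g, r₀, acc, hL, hR, h⟩ := h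
  exact ⟨L, R, iL, iR, f, l₀, g, r₀, acc, hL.trans hNM, hR.trans hNM, h⟩

theorem TwoSided.congr {p q : List Column → ℕ → Prop} {N : ℕ} (h : TwoSided p N)
    (hpq : ∀ w i, p w i ↔ q w i) : TwoSided q N := by
  obtain ⟨L, R, iL, iR, f, l₀, g, r₀, acc, hL, hR, h⟩ := h
  exact ⟨L, R, iL, iR, f, l₀, g, r₀, acc, hL, hR, fun x c y => (hpq _ _).symm.trans (h x c y)⟩

theorem TwoSided.not {p : List Column → ℕ → Prop} {N : ℕ} (h : TwoSided p N) :
    TwoSided (fun w i => ¬ p w i) N := by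
  obtain ⟨L, R, iL, iR, f, l₀, g, r₀, acc, hL, hR, h⟩ := h
  exact ⟨L, R, iL, iR, f, l₀, g, r₀, fun l c r => ¬ acc l c r, hL, hR,
    fun x c y => not_congr (h x c y)⟩

theorem TwoSided.of_column {p : List Column → ℕ → Prop} (q : Column → Prop)
    (h : ∀ w i, p w i ↔ q (w.getD i [])) : TwoSided p 1 :=
  ⟨Unit, Unit, inferInstance, inferInstance, fun _ _ => (), (), fun _ _ => (), (),
    fun _ c _ => q c, by simp, by simp, fun x c y => by rw [h]; simp⟩

theorem foldl_prodMk {α β γ : Type} (f : α → γ → α) (g : β → γ → β) (a : α) (b : β) (w : List γ) :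
    w.foldl (fun s c => (f s.1 c, g s.2 c)) (a, b) = (w.foldl f a, w.foldl g b) := by
  induction w generalizing a b with
  | nil => rfl
  | cons c w ih => exact ih _ _

theorem foldr_prodMk {α β γ : Type} (f : γ → α → α) (g : γ → β → β) (a : α) (b : β) (w : List γ) :
    w.foldr (fun c s => (f c s.1, g c s.2)) (a, b) = (w.foldr f a, w.foldr g b) := by
  induction w with
  | nil => rfl
  | cons c w ih => simp [ih]

/-- Two properties are recognized by a common pair of automata. -/
theorem TwoSided.exists_common {p q : List Column → ℕ → Prop} {N M : ℕ} (hp : TwoSided p N)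
    (hq : TwoSided q M) :
    ∃ (L R : Type) (_ : Fintype L) (_ : Fintype R) (f : L → Column → L) (l₀ : L)
      (g : Column → R → R) (r₀ : R) (accp accq : L → Column → R → Prop),
      Fintype.card L ≤ N * M ∧ Fintype.card R ≤ N * M ∧
      (∀ x c y, p (x ++ c :: y) x.length ↔ accp (x.foldl f l₀) c (y.foldr g r₀)) ∧
      ∀ x c y, q (x ++ c :: y) x.length ↔ accq (x.foldl f l₀) c (y.foldr g r₀) := by
  obtain ⟨L, R, iL, iR, f, l₀, g, r₀, acc, hL, hR, h⟩ := hp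
  obtain ⟨L', R', iL', iR', f', l₀', g', r₀', acc', hL', hR', h'⟩ := hq
  refine ⟨L × L', R × R', inferInstance, inferInstance, fun s c => (f s.1 c, f' s.2 c), (l₀, l₀'),
    fun c s => (g c s.1, g' c s.2), (r₀, r₀'), fun l c r => acc l.1 c r.1,
    fun l c r => acc' l.2 c r.2, ?_, ?_, fun x c y => ?_, fun x c y => ?_⟩
  · rw [Fintype.card_prod]; exact Nat.mul_le_mul hL hL'
  · rw [Fintype.card_prod]; exact Nat.mul_le_mul hR hR'
  · rw [foldl_prodMk, foldr_prodMk]; exact h x c y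
  · rw [foldl_prodMk, foldr_prodMk]; exact h' x c y

theorem TwoSided.and {p q : List Column → ℕ → Prop} {N M : ℕ} (hp : TwoSided p N)
    (hq : TwoSided q M) : TwoSided (fun w i => p w i ∧ q w i) (N * M) := by
  obtain ⟨L, R, iL, iR, f, l₀, g, r₀, accp, accq, hL, hR, h, h'⟩ := hp.exists_common hq
  exact ⟨L, R, iL, iR, f, l₀, g, r₀, fun l c r => accp l c r ∧ accq l c r, hL, hR,
    fun x c y => and_congr (h x c y) (h' x c y)⟩

/-- The truth of `p` and `q` at later positions depends on left states that an automaton arriving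
from the right does not know. It therefore records, for every left state in which its suffix could
be entered, whether the until is fulfilled inside that suffix. This predicate on `L` accounts for
the factor `2 ^ (N * M)`. -/
theorem TwoSided.until {p q : List Column → ℕ → Prop} {N M : ℕ} (hp : TwoSided p N)
    (hq : TwoSided q M) :
    TwoSided (fun w i => ∃ j, i < j ∧ w.getD j [] ≠ [] ∧ q w j ∧
      ∀ k, i < k → k < j → w.getD k [] ≠ [] → p w k) (N * M * 2 ^ (N * M)) := by
  obtain ⟨L, R, iL, iR, f, l₀, g, r₀, accp, accq, hL, hR, hp, hq⟩ := hp.exists_common hq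
  classical
  let step : Column → R × (L → Prop) → R × (L → Prop) := fun c s =>
    (g c s.1, fun l => (c ≠ [] ∧ accq l c s.1) ∨ ((c ≠ [] → accp l c s.1) ∧ s.2 (f l c)))
  have fst : ∀ y : List Column, (y.foldr step (r₀, fun _ => False)).1 = y.foldr g r₀ := by
    intro y
    induction y with
    | nil => rfl
    | cons c y ih => simp only [List.foldr_cons, ← ih]; rfl
  -- The recursion runs on the non-strict until, which may be fulfilled at the first column of `y`.
  -- The strict one at a column `c` is the non-strict one after `x ++ [c]`, hence `s.2 (f l c)` in
  -- the acceptance condition below.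
  have snd : ∀ (y x : List Column), (∃ j, x.length ≤ j ∧ (x ++ y).getD j [] ≠ [] ∧ q (x ++ y) j ∧
      ∀ k, x.length ≤ k → k < j → (x ++ y).getD k [] ≠ [] → p (x ++ y) k) ↔
      (y.foldr step (r₀, fun _ => False)).2 (x.foldl f l₀) := by
    intro y
    induction y with
    | nil =>
      intro x
      simp only [List.foldr_nil, iff_false]
      rintro ⟨j, hj, hne, -⟩
      exact hne (by simp [List.getD_eq_getElem?_getD, hj])
    | cons c y ih =>
      intro x
      have ih := ih (x ++ [c])
      rw [List.foldl_append, List.append_assoc, List.length_append] at ih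
      simp only [List.singleton_append, List.length_singleton, List.foldl_cons,
        List.foldl_nil] at ih
      simp only [List.foldr_cons, step, ← ih, fst, ← hp, ← hq]
      have hc : (x ++ c :: y).getD x.length [] = c := by simp
      constructor
      · rintro ⟨j, hj, hne, hqj, hpk⟩
        rcases hj.eq_or_lt with rfl | hj
        · exact Or.inl ⟨hc ▸ hne, hqj⟩
        · exact Or.inr ⟨fun h => hpk _ le_rfl hj (by rwa [hc]), j, hj, hne, hqj,
            fun k hk => hpk k (by omega)⟩
      · rintro (⟨h, hqj⟩ | ⟨h, j, hj, hne, hqj, hpk⟩)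
        · exact ⟨_, le_rfl, by rwa [hc], hqj, fun k h1 h2 => by omega⟩
        · refine ⟨j, by omega, hne, hqj, fun k h1 h2 h3 => ?_⟩
          rcases h1.eq_or_lt with rfl | h1
          · exact h (by rwa [hc] at h3)
          · exact hpk k h1 h2 h3
  refine ⟨L, R × (L → Prop), iL, inferInstance, f, l₀, step, (r₀, fun _ => False),
    fun l c s => s.2 (f l c), hL.trans (Nat.le_mul_of_pos_right _ (by positivity)), ?_,
    fun x c y => ?_⟩
  · rw [Fintype.card_prod, Fintype.card_fun, Fintype.card_prop]
    exact Nat.mul_le_mul hR (Nat.pow_le_pow_right (by norm_num) hL)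
  · have := snd y (x ++ [c])
    rw [List.foldl_append, List.append_assoc, List.length_append] at this
    exact this

/-- Mirror image of `TwoSided.until`: now the left state carries a predicate on right states. -/
theorem TwoSided.since {p q : List Column → ℕ → Prop} {N M : ℕ} (hp : TwoSided p N)
    (hq : TwoSided q M) :
    TwoSided (fun w i => ∃ j, j < i ∧ w.getD j [] ≠ [] ∧ q w j ∧
      ∀ k, j < k → k < i → w.getD k [] ≠ [] → p w k) (N * M * 2 ^ (N * M)) := by
  obtain ⟨L, R, iL, iR, f, l₀, g, r₀, accp, accq, hL, hR, hp, hq⟩ := hp.exists_common hq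
  classical
  let step : L × (R → Prop) → Column → L × (R → Prop) := fun s c =>
    (f s.1 c, fun r => (c ≠ [] ∧ accq s.1 c r) ∨ ((c ≠ [] → accp s.1 c r) ∧ s.2 (g c r)))
  have fst : ∀ x : List Column, (x.foldl step (l₀, fun _ => False)).1 = x.foldl f l₀ := by
    intro x
    induction x using List.reverseRecOn with
    | nil => rfl
    | append_singleton x c ih => simp only [List.foldl_append, ← ih]; rfl
  have snd : ∀ (x y : List Column), (∃ j, j < x.length ∧ (x ++ y).getD j [] ≠ [] ∧ q (x ++ y) j ∧
      ∀ k, j < k → k < x.length → (x ++ y).getD k [] ≠ [] → p (x ++ y) k) ↔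
      (x.foldl step (l₀, fun _ => False)).2 (y.foldr g r₀) := by
    intro x
    induction x using List.reverseRecOn with
    | nil =>
      intro y
      simp
    | append_singleton x c ih =>
      intro y
      have ih := ih (c :: y)
      simp only [List.foldl_append, List.append_assoc, List.length_append, List.singleton_append,
        List.length_singleton, List.foldl_cons, List.foldl_nil]
      rw [List.foldr_cons] at ih
      simp only [step] at ih ⊢
      rw [← ih]
      simp only [step] at fst
      rw [fst, ← hp, ← hq]
      have hc : (x ++ c :: y).getD x.length [] = c := by simp
      constructor
      · rintro ⟨j, hj, hne, hqj, hpk⟩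
        rcases (Nat.lt_succ_iff.1 hj).eq_or_lt with rfl | hj
        · exact Or.inl ⟨hc ▸ hne, hqj⟩
        · exact Or.inr ⟨fun h => hpk _ hj (by omega) (by rwa [hc]), j, hj, hne, hqj,
            fun k hk h => hpk k hk (by omega)⟩
      · rintro (⟨h, hqj⟩ | ⟨h, j, hj, hne, hqj, hpk⟩)
        · exact ⟨_, by omega, by rwa [hc], hqj, fun k h1 h2 => by omega⟩
        · refine ⟨j, by omega, hne, hqj, fun k h1 h2 h3 => ?_⟩
          rcases (Nat.lt_succ_iff.1 h2).eq_or_lt with rfl | h2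
          · exact h (by rwa [hc] at h3)
          · exact hpk k h1 h2 h3
  refine ⟨L × (R → Prop), R, inferInstance, iR, step, (l₀, fun _ => False), g, r₀,
    fun s c r => s.2 (g c r), ?_, hR.trans (Nat.le_mul_of_pos_right _ (by positivity)),
    fun x c y => snd x (c :: y)⟩
  rw [Fintype.card_prod, Fintype.card_fun, Fintype.card_prop]
  exact Nat.mul_le_mul hL (Nat.pow_le_pow_right (by norm_num) hR)

/-- The words whose first position has a property that is recognized from both sides are
recognized by an automaton. -/
theorem TwoSided.recognizable {p : List Column → ℕ → Prop} {N : ℕ} (h : TwoSided p N) :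
    Recognizable (fun w => w ≠ [] ∧ p w 0) (2 ^ N + 1) := by
  obtain ⟨L, R, iL, iR, f, l₀, g, r₀, acc, hL, hR, h⟩ := h
  classical
  -- Reading from left to right, the state is a predicate: which right states of the unread suffix
  -- lead to acceptance. At the end the suffix is empty and its state is `r₀`. The state `none`
  -- means that nothing has been read; `TwoSided` says nothing about the empty word.
  let D : DFA Column (Option (R → Prop)) :=
    ⟨fun s c => match s with
      | none => some fun r => acc l₀ c r
      | some φ => some fun r => φ (g c r), none, {s | ∃ φ, s = some φ ∧ φ r₀}⟩
  have key : ∀ (y : List Column) φ,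
      D.evalFrom (some φ) y = some fun r => φ (y.foldr g r) := by
    intro y
    induction y with
    | nil => intro φ; rfl
    | cons c y ih => intro φ; rw [DFA.evalFrom_cons]; exact ih _
  refine ⟨Option (R → Prop), inferInstance, D, ?_, fun w => ?_⟩
  · rw [Fintype.card_option, Fintype.card_fun, Fintype.card_prop]
    exact Nat.add_le_add_right (Nat.pow_le_pow_right (by norm_num) hR) 1
  · cases w with
    | nil => simp [D]
    | cons c y =>
      have h1 : D.eval (c :: y) = some fun r => acc l₀ c (y.foldr g r) := key y _
      have h2 := h [] c y
      rw [h1]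
      simp only [List.nil_append, List.length_nil, List.foldl_nil] at h2
      simp [D, h2]

/-! ### The size of the automata for quantifier-free formulae -/

/-- The argument is a Gödel number, not a formula. Subformulae have strictly smaller codes, so
iterating the growth caused by one until as often as the code says is a crude bound that can be
computed from the code alone. -/
def sideBound : ℕ → ℕ
  | 0 => 1
  | m + 1 => sideBound m * sideBound m * 2 ^ (sideBound m * sideBound m)

theorem sideBound_pos (m : ℕ) : 0 < sideBound m := by
  induction m with
  | zero => exact Nat.one_pos
  | succ m ih => rw [sideBound]; positivity

theorem sideBound_mul_le {a b m : ℕ} (ha : sideBound a ≤ sideBound m)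
    (hb : sideBound b ≤ sideBound m) :
    sideBound a * sideBound b * 2 ^ (sideBound a * sideBound b) ≤ sideBound (m + 1) := by
  have := Nat.mul_le_mul ha hb
  exact Nat.mul_le_mul this (Nat.pow_le_pow_right (by norm_num) this)

theorem sideBound_mono : Monotone sideBound := by
  refine monotone_nat_of_le_succ fun m => ?_
  have h := sideBound_pos m
  rw [sideBound, mul_assoc]
  exact Nat.le_mul_of_pos_right _ (by positivity)

/-- Compound formulae have positive tags, so their codes strictly exceed those of their parts. Both
the bound and the evaluation table rely on this. -/
theorem lt_pair_of_pos {t r : ℕ} (ht : 0 < t) : r < Nat.pair t r :=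
  (Nat.lt_add_of_pos_left ht).trans_le (Nat.add_le_pair t r)

theorem QFree.code_left_lt {n : ℕ} (a b : QFree n) {t : ℕ} (ht : 0 < t) :
    a.code < Nat.pair t (Nat.pair a.code b.code) :=
  (Nat.left_le_pair _ _).trans_lt (lt_pair_of_pos ht)

theorem QFree.code_right_lt {n : ℕ} (a b : QFree n) {t : ℕ} (ht : 0 < t) :
    b.code < Nat.pair t (Nat.pair a.code b.code) :=
  (Nat.right_le_pair _ _).trans_lt (lt_pair_of_pos ht)

theorem QFree.code_left_lt' {n : ℕ} (I : Interval) (a b : QFree n) {t : ℕ} (ht : 0 < t) :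
    a.code < Nat.pair t (Nat.pair I.code (Nat.pair a.code b.code)) :=
  ((Nat.left_le_pair _ _).trans (Nat.right_le_pair _ _)).trans_lt (lt_pair_of_pos ht)

theorem QFree.code_right_lt' {n : ℕ} (I : Interval) (a b : QFree n) {t : ℕ} (ht : 0 < t) :
    b.code < Nat.pair t (Nat.pair I.code (Nat.pair a.code b.code)) :=
  ((Nat.right_le_pair _ _).trans (Nat.right_le_pair _ _)).trans_lt (lt_pair_of_pos ht)

theorem sideBound_le_of_lt {a b m : ℕ} (ha : a < m) (hb : b < m) :
    sideBound a * sideBound b * 2 ^ (sideBound a * sideBound b) ≤ sideBound m := by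
  cases m with
  | zero => omega
  | succ m =>
    exact sideBound_mul_le (sideBound_mono (Nat.lt_succ_iff.1 ha))
      (sideBound_mono (Nat.lt_succ_iff.1 hb))

/-- Both signs go through the induction, because `ψ.nnf false` is not the complement of `ψ.nnf
true`: neither `prop` nor `negProp` holds where the trace has no event. -/
theorem QFree.twoSided_holds {n : ℕ} (ψ : QFree n) (s : Bool) :
    TwoSided (fun w i => (ψ.nnf s).Holds w i) (sideBound ψ.code) := by
  have mul_le : ∀ {a b m : ℕ}, a < m → b < m → sideBound a * sideBound b ≤ sideBound m :=
    fun ha hb => (Nat.le_mul_of_pos_right _ (by positivity)).trans (sideBound_le_of_lt ha hb)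
  induction ψ generalizing s with
  | top =>
    cases s
    · exact (TwoSided.of_column (· = []) fun w i => Iff.rfl).mono (sideBound_pos _)
    · exact (TwoSided.of_column (· ≠ []) fun w i => Iff.rfl).mono (sideBound_pos _)
  | topOf π =>
    cases s
    · exact (TwoSided.of_column (fun c => ¬ ∃ l, (π, l) ∈ c) fun w i => Iff.rfl).mono
        (sideBound_pos _)
    · exact (TwoSided.of_column (fun c => ∃ l, (π, l) ∈ c) fun w i => Iff.rfl).mono
        (sideBound_pos _)
  | prop p π =>
    cases s
    · exact (TwoSided.of_column (fun c => ∃ l, (π, l) ∈ c ∧ p.val ∉ l) fun w i => Iff.rfl).mono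
        (sideBound_pos _)
    · exact (TwoSided.of_column (fun c => ∃ l, (π, l) ∈ c ∧ p.val ∈ l) fun w i => Iff.rfl).mono
        (sideBound_pos _)
  | and a b iha ihb =>
    have hle := mul_le (a.code_left_lt b (t := 3) (by norm_num))
      (a.code_right_lt b (t := 3) (by norm_num))
    cases s
    · refine ((((iha false).not.and (ihb false).not).not).congr fun w i => ?_).mono hle
      simp only [not_and_or, not_not]
      rfl
    · exact ((iha true).and (ihb true)).mono hle
  | neg a ih =>
    have hle := sideBound_mono (lt_pair_of_pos (t := 4) (r := a.code) (by norm_num)).le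
    cases s
    · exact (ih true).mono hle
    · exact (ih false).mono hle
  | untl I a b iha ihb =>
    have hle := sideBound_le_of_lt (a.code_left_lt' I b (t := 5) (by norm_num))
      (a.code_right_lt' I b (t := 5) (by norm_num))
    cases s
    -- The dual operator is the complement of the until of the complements of its own arguments, so
    -- no further automaton is needed.
    · refine ((((iha false).not.until (ihb false).not).not).congr fun w i => ?_).mono hle
      simp only [QFree.nnf, NNF.Holds]
      push Not
      refine forall_congr' fun j => forall_congr' fun _ => forall_congr' fun _ => ?_
      rw [or_iff_not_imp_left]
    · exact ((iha true).until (ihb true)).mono hle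
  | snce I a b iha ihb =>
    have hle := sideBound_le_of_lt (a.code_left_lt' I b (t := 6) (by norm_num))
      (a.code_right_lt' I b (t := 6) (by norm_num))
    cases s
    · refine ((((iha false).not.since (ihb false).not).not).congr fun w i => ?_).mono hle
      simp only [QFree.nnf, NNF.Holds]
      push Not
      refine forall_congr' fun j => forall_congr' fun _ => forall_congr' fun _ => ?_
      rw [or_iff_not_imp_left]
    · exact ((iha true).since (ihb true)).mono hle

/-! ### Quantifiers over words of columns -/

/-- The words of columns that satisfy a formula if its quantifiers range over the sequences of
letters accepted by `A`, inserted in all possible ways. -/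
def HyperMTL.Holds {n : ℕ} (A : TimedAutomaton (Letter n)) (alph : List (List ℕ)) :
    HyperMTL n → List Column → Prop
  | .ex π φ, w => ∃ z, Insertion π alph w z ∧ A.CodeRun A.start (letters π z) ∧ φ.Holds A alph z
  | .all π φ, w => ∀ z, Insertion π alph w z → A.CodeRun A.start (letters π z) → φ.Holds A alph z
  | .qfree ψ, w => w ≠ [] ∧ (ψ.nnf true).Holds w 0

/-- A bound for the number of states, given the number of locations, the quantifier prefix, and
the code of the quantifier-free part. -/
def stateBound (k : ℕ) : List (Bool × ℕ) → ℕ → ℕ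
  | [], m => 2 ^ sideBound m + 1
  | _ :: l, m => 2 ^ (2 ^ k * stateBound k l m)

/-- Each quantifier costs a product with the determinized model, which has at most `2 ^ A.numLoc`
states, and one powerset construction. A universal quantifier is the complement of an existential
one over the complement. -/
theorem HyperMTL.recognizable_holds {n : ℕ} (A : TimedAutomaton (Letter n))
    (alph : List (List ℕ)) (φ : HyperMTL n) :
    Recognizable (φ.Holds A alph) (stateBound A.numLoc φ.code.1 φ.code.2) := by
  induction φ with
  | ex π φ ih => exact ((A.recognizable_codeRun.letters π).and ih).exists_insertion π alph
  | all π φ ih =>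
    refine ((((A.recognizable_codeRun.letters π).and ih.not).exists_insertion π alph).not).congr
      fun w => ?_
    simp only [HyperMTL.Holds]
    push Not
    rfl
  | qfree ψ => exact (ψ.twoSided_holds true).recognizable

theorem HyperMTL.holds_ex_iff {n : ℕ} (A : TimedAutomaton (Letter n)) (alph : List (List ℕ))
    (π : ℕ) (φ : HyperMTL n) (w : List Column) :
    (HyperMTL.ex π φ).Holds A alph w ↔
      ∃ z ∈ insertions π alph (2 ^ A.numLoc * stateBound A.numLoc φ.code.1 φ.code.2) w,
        A.CodeRun A.start (letters π z) ∧ φ.Holds A alph z :=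
  (((A.recognizable_codeRun.letters π).and (φ.recognizable_holds A alph)).exists_insertion_iff
    π alph w).symm

theorem HyperMTL.holds_all_iff {n : ℕ} (A : TimedAutomaton (Letter n)) (alph : List (List ℕ))
    (π : ℕ) (φ : HyperMTL n) (w : List Column) :
    (HyperMTL.all π φ).Holds A alph w ↔
      ∀ z ∈ insertions π alph (2 ^ A.numLoc * stateBound A.numLoc φ.code.1 φ.code.2) w,
        A.CodeRun A.start (letters π z) → φ.Holds A alph z := by
  have h := ((A.recognizable_codeRun.letters π).and
    (φ.recognizable_holds A alph).not).exists_insertion_iff π alph w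
  have h := not_congr h
  push Not at h
  exact h.symm

/-! ### Primitive recursive evaluation of quantifier-free formulae -/

theorem primrecRel_mem {α : Type} [Primcodable α] :
    PrimrecRel fun (L : List α) (a : α) => a ∈ L :=
  (PrimrecRel.exists_mem_list (R := fun a b : α => a = b) Primrec.eq).of_eq fun L a => by simp

/-- The table with entries `g a []`, `g a [g a []]`, …, each computed from the previous ones. -/
def tableRec {α σ : Type} (g : α → List σ → σ) (a : α) : ℕ → List σ
  | 0 => []
  | m + 1 => tableRec g a m ++ [g a (tableRec g a m)]

/-- Course-of-values recursion; the step function reads off its own index as the length of the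
table. -/
theorem primrec_tableRec {α σ : Type} [Primcodable α] [Primcodable σ] {g : α → List σ → σ}
    (hg : Primrec₂ g) : Primrec₂ (tableRec g) := by
  have h : Primrec₂ fun (a : α) (p : ℕ × List σ) => p.2 ++ [g a p.2] :=
    (Primrec.list_concat.comp (Primrec.snd.comp Primrec.snd)
      (hg.comp Primrec.fst (Primrec.snd.comp Primrec.snd))).to₂
  refine (Primrec.nat_rec (Primrec.const []) h).of_eq fun a m => ?_
  induction m with
  | zero => rfl
  | succ m ih => simp only [tableRec, ← ih]

theorem length_tableRec {α σ : Type} (g : α → List σ → σ) (a : α) (m : ℕ) :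
    (tableRec g a m).length = m := by
  induction m with
  | zero => rfl
  | succ m ih => simp [tableRec, ih]

theorem tableRec_getD {α σ : Type} (g : α → List σ → σ) (a : α) {m k : ℕ} (h : k < m) (d : σ) :
    (tableRec g a m).getD k d = g a (tableRec g a k) := by
  induction m with
  | zero => omega
  | succ m ih =>
    simp only [tableRec, List.getD_eq_getElem?_getD] at ih ⊢
    rcases (Nat.lt_succ_iff.1 h).eq_or_lt with rfl | h'
    · rw [List.getElem?_append_right (by rw [length_tableRec])]
      simp [length_tableRec]
    · rw [List.getElem?_append_left (by rwa [length_tableRec]), ih h']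

/-- Until at position `i`, for arguments that hold at the positions in `S` and `T`. -/
def UntilAt (w : List Column) (S T : List ℕ) (i : ℕ) : Prop :=
  ∃ j < w.length, i < j ∧ w.getD j [] ≠ [] ∧ j ∈ T ∧ ∀ k < j, k ≤ i ∨ w.getD k [] = [] ∨ k ∈ S

/-- Quantifiers are bounded and implications written as disjunctions, to fit the closure properties
of primitive recursive predicates. The bound `w.length` loses nothing: beyond it the column is the
default `[]`, which does not count as a time. -/
def DualUntilAt (w : List Column) (S T : List ℕ) (i : ℕ) : Prop :=
  ∀ j < w.length, j ≤ i ∨ w.getD j [] = [] ∨ j ∈ T ∨ ∃ k < j, i < k ∧ w.getD k [] ≠ [] ∧ k ∈ S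

def SinceAt (w : List Column) (S T : List ℕ) (i : ℕ) : Prop :=
  ∃ j < i, w.getD j [] ≠ [] ∧ j ∈ T ∧ ∀ k < i, k ≤ j ∨ w.getD k [] = [] ∨ k ∈ S

def DualSinceAt (w : List Column) (S T : List ℕ) (i : ℕ) : Prop :=
  ∀ j < i, w.getD j [] = [] ∨ j ∈ T ∨ ∃ k < i, j < k ∧ w.getD k [] ≠ [] ∧ k ∈ S

section Primrec

open Primrec

variable {α : Type} [Primcodable α] {w : α → List Column} {S T : α → List ℕ} {i : α → ℕ}

theorem primrecPred_exists_mem {β : Type} [Primcodable β] {p : α → β → Prop} {b : α → List β}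
    (hb : Primrec b) (hp : PrimrecPred fun x : α × β => p x.1 x.2) :
    PrimrecPred fun a => ∃ j ∈ b a, p a j :=
  (PrimrecRel.exists_mem_list (R := fun j a => p a j) (hp.comp (snd.pair fst))).comp hb Primrec.id

theorem primrecPred_exists_lt {p : α → ℕ → Prop} {b : α → ℕ} (hb : Primrec b)
    (hp : PrimrecPred fun x : α × ℕ => p x.1 x.2) : PrimrecPred fun a => ∃ j < b a, p a j :=
  (primrecPred_exists_mem (list_range.comp hb) hp).of_eq fun a => by simp

theorem primrecPred_forall_lt {p : α → ℕ → Prop} {b : α → ℕ} (hb : Primrec b)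
    (hp : PrimrecPred fun x : α × ℕ => p x.1 x.2) : PrimrecPred fun a => ∀ j < b a, p a j :=
  (primrecPred_exists_lt (p := fun a j => ¬ p a j) hb hp.not).not.of_eq fun a => by simp

theorem primrecPred_column_eq_nil (hw : Primrec w) (hi : Primrec i) :
    PrimrecPred fun a => (w a).getD (i a) [] = [] :=
  Primrec.eq.comp ((list_getD _).comp hw hi) (const _)

theorem primrecPred_untilAt (hw : Primrec w) (hS : Primrec S) (hT : Primrec T) (hi : Primrec i) :
    PrimrecPred fun a => UntilAt (w a) (S a) (T a) (i a) := by
  refine primrecPred_exists_lt (list_length.comp hw) ?_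
  refine (nat_lt.comp (hi.comp fst) snd).and
    ((primrecPred_column_eq_nil (hw.comp fst) snd).not.and
      ((primrecRel_mem.comp (hT.comp fst) snd).and (primrecPred_forall_lt snd ?_)))
  exact (nat_le.comp snd (hi.comp (fst.comp fst))).or
    ((primrecPred_column_eq_nil (hw.comp (fst.comp fst)) snd).or
      (primrecRel_mem.comp (hS.comp (fst.comp fst)) snd))

theorem primrecPred_dualUntilAt (hw : Primrec w) (hS : Primrec S) (hT : Primrec T)
    (hi : Primrec i) : PrimrecPred fun a => DualUntilAt (w a) (S a) (T a) (i a) := by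
  refine primrecPred_forall_lt (list_length.comp hw) ?_
  refine (nat_le.comp snd (hi.comp fst)).or
    ((primrecPred_column_eq_nil (hw.comp fst) snd).or
      ((primrecRel_mem.comp (hT.comp fst) snd).or (primrecPred_exists_lt snd ?_)))
  exact (nat_lt.comp (hi.comp (fst.comp fst)) snd).and
    ((primrecPred_column_eq_nil (hw.comp (fst.comp fst)) snd).not.and
      (primrecRel_mem.comp (hS.comp (fst.comp fst)) snd))

theorem primrecPred_sinceAt (hw : Primrec w) (hS : Primrec S) (hT : Primrec T) (hi : Primrec i) :
    PrimrecPred fun a => SinceAt (w a) (S a) (T a) (i a) := by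
  refine primrecPred_exists_lt hi ?_
  refine (primrecPred_column_eq_nil (hw.comp fst) snd).not.and
    ((primrecRel_mem.comp (hT.comp fst) snd).and (primrecPred_forall_lt (hi.comp fst) ?_))
  exact (nat_le.comp snd (snd.comp fst)).or
    ((primrecPred_column_eq_nil (hw.comp (fst.comp fst)) snd).or
      (primrecRel_mem.comp (hS.comp (fst.comp fst)) snd))

theorem primrecPred_dualSinceAt (hw : Primrec w) (hS : Primrec S) (hT : Primrec T)
    (hi : Primrec i) : PrimrecPred fun a => DualSinceAt (w a) (S a) (T a) (i a) := by
  refine primrecPred_forall_lt hi ?_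
  refine (primrecPred_column_eq_nil (hw.comp fst) snd).or
    ((primrecRel_mem.comp (hT.comp fst) snd).or (primrecPred_exists_lt (hi.comp fst) ?_))
  exact (nat_lt.comp (snd.comp fst) snd).and
    ((primrecPred_column_eq_nil (hw.comp (fst.comp fst)) snd).not.and
      (primrecRel_mem.comp (hS.comp (fst.comp fst)) snd))

end Primrec

/-- For a formula, the positions where it holds and those where its negation holds. -/
abbrev Positions : Type := List ℕ × List ℕ

/-- Given the table for smaller codes, whether the formula whose code is the length of the table
holds at position `i`. -/
def PosStep (w : List Column) (t : List Positions) (i : ℕ) : Prop :=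
  let r := t.length.unpair.2
  let f := fun c => t.getD c ([], [])
  (t.length.unpair.1 = 0 ∧ ¬ w.getD i [] = []) ∨
  (t.length.unpair.1 = 1 ∧ ∃ e ∈ w.getD i [], e.1 = r) ∨
  (t.length.unpair.1 = 2 ∧ ∃ e ∈ w.getD i [], e.1 = r.unpair.2 ∧ r.unpair.1 ∈ e.2) ∨
  (t.length.unpair.1 = 3 ∧ i ∈ (f r.unpair.1).1 ∧ i ∈ (f r.unpair.2).1) ∨
  (t.length.unpair.1 = 4 ∧ i ∈ (f r).2) ∨
  (t.length.unpair.1 = 5 ∧ UntilAt w (f r.unpair.2.unpair.1).1 (f r.unpair.2.unpair.2).1 i) ∨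
  (t.length.unpair.1 = 6 ∧ SinceAt w (f r.unpair.2.unpair.1).1 (f r.unpair.2.unpair.2).1 i)

/-- As `PosStep`, for the negation of the formula. -/
def NegStep (w : List Column) (t : List Positions) (i : ℕ) : Prop :=
  let r := t.length.unpair.2
  let f := fun c => t.getD c ([], [])
  (t.length.unpair.1 = 0 ∧ w.getD i [] = []) ∨
  (t.length.unpair.1 = 1 ∧ ¬ ∃ e ∈ w.getD i [], e.1 = r) ∨
  (t.length.unpair.1 = 2 ∧ ∃ e ∈ w.getD i [], e.1 = r.unpair.2 ∧ ¬ r.unpair.1 ∈ e.2) ∨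
  (t.length.unpair.1 = 3 ∧ (i ∈ (f r.unpair.1).2 ∨ i ∈ (f r.unpair.2).2)) ∨
  (t.length.unpair.1 = 4 ∧ i ∈ (f r).1) ∨
  (t.length.unpair.1 = 5 ∧ DualUntilAt w (f r.unpair.2.unpair.1).2 (f r.unpair.2.unpair.2).2 i) ∨
  (t.length.unpair.1 = 6 ∧ DualSinceAt w (f r.unpair.2.unpair.1).2 (f r.unpair.2.unpair.2).2 i)

section Primrec

open Primrec

theorem primrec_length_table : Primrec fun x : (List Column × List Positions) × ℕ =>
    x.1.2.length.unpair :=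
  unpair.comp (list_length.comp (snd.comp fst))

theorem primrec_positions {c : (List Column × List Positions) × ℕ → ℕ} (hc : Primrec c) :
    Primrec fun x : (List Column × List Positions) × ℕ => x.1.2.getD (c x) ([], []) :=
  (list_getD _).comp (snd.comp fst) hc

theorem primrec_column : Primrec fun x : (List Column × List Positions) × ℕ =>
    x.1.1.getD x.2 [] :=
  (list_getD _).comp (fst.comp fst) snd

theorem primrecPred_posStep :
    PrimrecPred fun x : (List Column × List Positions) × ℕ => PosStep x.1.1 x.1.2 x.2 := by
  have ht := fst.comp primrec_length_table
  have hr := snd.comp primrec_length_table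
  have hr1 := fst.comp (unpair.comp hr)
  have hr2 := snd.comp (unpair.comp hr)
  have hr3 := fst.comp (unpair.comp hr2)
  have hr4 := snd.comp (unpair.comp hr2)
  have hw := fst.comp (fst (α := List Column × List Positions) (β := ℕ))
  have tag : ∀ m : ℕ, PrimrecPred fun x : (List Column × List Positions) × ℕ =>
    x.1.2.length.unpair.1 = m := fun m => Primrec.eq.comp ht (const m)
  refine ((tag 0).and (primrecPred_column_eq_nil hw snd).not).or
    (((tag 1).and (primrecPred_exists_mem primrec_column ?_)).or
    (((tag 2).and (primrecPred_exists_mem primrec_column ?_)).or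
    (((tag 3).and ((primrecRel_mem.comp (fst.comp (primrec_positions hr1)) snd).and
      (primrecRel_mem.comp (fst.comp (primrec_positions hr2)) snd))).or
    (((tag 4).and (primrecRel_mem.comp (snd.comp (primrec_positions hr)) snd)).or
    (((tag 5).and (primrecPred_untilAt hw (fst.comp (primrec_positions hr3))
      (fst.comp (primrec_positions hr4)) snd)).or
    ((tag 6).and (primrecPred_sinceAt hw (fst.comp (primrec_positions hr3))
      (fst.comp (primrec_positions hr4)) snd)))))))
  · exact Primrec.eq.comp (fst.comp snd) (hr.comp fst)
  · exact (Primrec.eq.comp (fst.comp snd) (hr2.comp fst)).and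
      (primrecRel_mem.comp (snd.comp snd) (hr1.comp fst))

theorem primrecPred_negStep :
    PrimrecPred fun x : (List Column × List Positions) × ℕ => NegStep x.1.1 x.1.2 x.2 := by
  have ht := fst.comp primrec_length_table
  have hr := snd.comp primrec_length_table
  have hr1 := fst.comp (unpair.comp hr)
  have hr2 := snd.comp (unpair.comp hr)
  have hr3 := fst.comp (unpair.comp hr2)
  have hr4 := snd.comp (unpair.comp hr2)
  have hw := fst.comp (fst (α := List Column × List Positions) (β := ℕ))
  have tag : ∀ m : ℕ, PrimrecPred fun x : (List Column × List Positions) × ℕ =>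
    x.1.2.length.unpair.1 = m := fun m => Primrec.eq.comp ht (const m)
  refine ((tag 0).and (primrecPred_column_eq_nil hw snd)).or
    (((tag 1).and (primrecPred_exists_mem primrec_column ?_).not).or
    (((tag 2).and (primrecPred_exists_mem primrec_column ?_)).or
    (((tag 3).and ((primrecRel_mem.comp (snd.comp (primrec_positions hr1)) snd).or
      (primrecRel_mem.comp (snd.comp (primrec_positions hr2)) snd))).or
    (((tag 4).and (primrecRel_mem.comp (fst.comp (primrec_positions hr)) snd)).or
    (((tag 5).and (primrecPred_dualUntilAt hw (snd.comp (primrec_positions hr3))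
      (snd.comp (primrec_positions hr4)) snd)).or
    ((tag 6).and (primrecPred_dualSinceAt hw (snd.comp (primrec_positions hr3))
      (snd.comp (primrec_positions hr4)) snd)))))))
  · exact Primrec.eq.comp (fst.comp snd) (hr.comp fst)
  · exact (Primrec.eq.comp (fst.comp snd) (hr2.comp fst)).and
      (primrecRel_mem.comp (snd.comp snd) (hr1.comp fst)).not

open Classical in
/-- The entry of the table for the formula whose code is the length of the table. -/
noncomputable def evalStep (w : List Column) (t : List Positions) : Positions :=
  ((List.range w.length).filter fun i => PosStep w t i,
    (List.range w.length).filter fun i => NegStep w t i)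

theorem primrec_evalStep : Primrec₂ evalStep := by
  classical
  have h1 := PrimrecRel.listFilter (R := fun i (x : List Column × List Positions) =>
    PosStep x.1 x.2 i) (primrecPred_posStep.comp (snd.pair fst))
  have h2 := PrimrecRel.listFilter (R := fun i (x : List Column × List Positions) =>
    NegStep x.1 x.2 i) (primrecPred_negStep.comp (snd.pair fst))
  have hr : Primrec fun x : List Column × List Positions => List.range x.1.length :=
    list_range.comp (list_length.comp fst)
  exact ((h1.comp hr Primrec.id).pair (h2.comp hr Primrec.id)).of_eq fun _ => rfl

end Primrec

/-- The positions where the formula with code `m` holds and those where its negation holds. -/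
noncomputable def evalCode (w : List Column) (m : ℕ) : Positions :=
  evalStep w (tableRec evalStep w m)

theorem primrec_evalCode : Primrec₂ evalCode :=
  primrec_evalStep.comp Primrec.fst (primrec_tableRec primrec_evalStep)

theorem mem_evalCode_fst {w : List Column} {m i : ℕ} :
    i ∈ (evalCode w m).1 ↔ i < w.length ∧ PosStep w (tableRec evalStep w m) i := by
  simp [evalCode, evalStep]

theorem mem_evalCode_snd {w : List Column} {m i : ℕ} :
    i ∈ (evalCode w m).2 ↔ i < w.length ∧ NegStep w (tableRec evalStep w m) i := by
  simp [evalCode, evalStep]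

theorem lt_length_of_getD_ne_nil {w : List Column} {j : ℕ} (h : w.getD j [] ≠ []) :
    j < w.length := by
  by_contra hj
  exact h (by simp [List.getD_eq_getElem?_getD, Nat.le_of_not_lt hj])

/-- The two signs are proved together, since negation exchanges them. The interval stored in the
code is skipped, just as `NNF.Holds` ignores it. -/
theorem evalCode_spec {n : ℕ} (w : List Column) (ψ : QFree n) {i : ℕ} (hi : i < w.length) :
    (i ∈ (evalCode w ψ.code).1 ↔ (ψ.nnf true).Holds w i) ∧
      (i ∈ (evalCode w ψ.code).2 ↔ (ψ.nnf false).Holds w i) := by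
  have get : ∀ {k m : ℕ}, k < m → (tableRec evalStep w m).getD k ([], []) = evalCode w k :=
    fun h => tableRec_getD _ _ h _
  have len : ∀ {j}, w.getD j [] ≠ [] → j < w.length := lt_length_of_getD_ne_nil
  induction ψ generalizing i with
  | top =>
    simp [mem_evalCode_fst, mem_evalCode_snd, hi, PosStep, NegStep, length_tableRec, QFree.code,
      QFree.nnf, NNF.Holds]
  | topOf π =>
    simp [mem_evalCode_fst, mem_evalCode_snd, hi, PosStep, NegStep, length_tableRec, QFree.code,
      QFree.nnf, NNF.Holds]
  | prop p π =>
    simp [mem_evalCode_fst, mem_evalCode_snd, hi, PosStep, NegStep, length_tableRec, QFree.code,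
      QFree.nnf, NNF.Holds]
  | and a b iha ihb =>
    have ha := a.code_left_lt b (t := 3) (by norm_num)
    have hb := a.code_right_lt b (t := 3) (by norm_num)
    rw [mem_evalCode_fst, mem_evalCode_snd]
    simp [hi, PosStep, NegStep, length_tableRec, QFree.code, QFree.nnf, NNF.Holds, get ha, get hb,
      iha hi, ihb hi, -List.getD_eq_getElem?_getD]
  | neg a ih =>
    have ha := lt_pair_of_pos (t := 4) (r := a.code) (by norm_num)
    rw [mem_evalCode_fst, mem_evalCode_snd]
    simp [hi, PosStep, NegStep, length_tableRec, QFree.code, QFree.nnf, get ha, ih hi,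
      -List.getD_eq_getElem?_getD]
  | untl I a b iha ihb =>
    have ha := a.code_left_lt' I b (t := 5) (by norm_num)
    have hb := a.code_right_lt' I b (t := 5) (by norm_num)
    rw [mem_evalCode_fst, mem_evalCode_snd]
    simp only [hi, true_and, PosStep, NegStep, length_tableRec, QFree.code, Nat.unpair_pair,
      get ha, get hb, UntilAt, DualUntilAt, OfNat.ofNat_ne_zero, OfNat.ofNat_ne_one, false_and,
      false_or, or_false, Nat.reduceEqDiff, QFree.nnf, NNF.Holds]
    constructor
    · refine exists_congr fun j => ?_
      grind
    · refine forall_congr' fun j => ?_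
      grind
  | snce I a b iha ihb =>
    have ha := a.code_left_lt' I b (t := 6) (by norm_num)
    have hb := a.code_right_lt' I b (t := 6) (by norm_num)
    rw [mem_evalCode_fst, mem_evalCode_snd]
    simp only [hi, true_and, PosStep, NegStep, length_tableRec, QFree.code, Nat.unpair_pair,
      get ha, get hb, SinceAt, DualSinceAt, OfNat.ofNat_ne_zero, OfNat.ofNat_ne_one, false_and,
      false_or, Nat.reduceEqDiff, QFree.nnf, NNF.Holds]
    constructor
    · refine exists_congr fun j => ?_
      grind
    · refine forall_congr' fun j => ?_
      grind

section Primrec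

open Primrec

/-! ### Primitive recursive enumeration of insertions -/

theorem primrec_gaps : Primrec₂ fun (x : ℕ × List (List ℕ)) (B : ℕ) => gaps x.1 x.2 B := by
  have hm : Primrec fun x : (((ℕ × List (List ℕ)) × (ℕ × List (List Column))) × List ℕ) ×
      List Column => [(x.1.1.1.1, x.1.2)] :: x.2 :=
    list_cons.comp (list_cons.comp ((fst.comp (fst.comp (fst.comp fst))).pair (snd.comp fst))
      (const [])) snd
  have hf : Primrec fun x : ((ℕ × List (List ℕ)) × (ℕ × List (List Column))) × List ℕ =>
      x.1.2.2.map fun v => [(x.1.1.1, x.2)] :: v :=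
    list_map (snd.comp (snd.comp fst)) hm.to₂
  have hs : Primrec fun x : (ℕ × List (List ℕ)) × (ℕ × List (List Column)) =>
      ([] : List Column) :: x.1.2.flatMap fun σ => x.2.2.map fun v => [(x.1.1, σ)] :: v :=
    list_cons.comp (const []) (list_flatMap (snd.comp fst) hf.to₂)
  refine (nat_rec (const [[]]) hs.to₂).of_eq fun x B => ?_
  induction B with
  | zero => rfl
  | succ B ih => simp only [gaps, ← ih]

theorem primrec_insertions :
    Primrec fun x : ((ℕ × List (List ℕ)) × ℕ) × List Column =>
      insertions x.1.1.1 x.1.1.2 x.1.2 x.2 := by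
  let X := ((ℕ × List (List ℕ)) × ℕ) × List Column
  let Y := X × (Column × List (List Column))
  have h1 : Primrec fun y : ((Y × Column) × List Column) × List Column =>
      y.1.1.2 :: (y.1.2 ++ y.2) :=
    list_cons.comp (snd.comp (fst.comp fst)) (list_append.comp (snd.comp fst) snd)
  have h2 : Primrec fun y : (Y × Column) × List Column =>
      y.1.1.2.2.map fun w' => y.1.2 :: (y.2 ++ w') :=
    list_map (snd.comp (snd.comp (fst.comp fst))) h1.to₂
  have h3 : Primrec fun y : Y × Column =>
      (gaps y.1.1.1.1.1 y.1.1.1.1.2 y.1.1.1.2).flatMap fun v =>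
        y.1.2.2.map fun w' => y.2 :: (v ++ w') :=
    list_flatMap (primrec_gaps.comp (fst.comp (fst.comp (fst.comp fst))) (snd.comp (fst.comp (fst.comp fst)))) h2.to₂
  have h4 : Primrec fun y : Y × List ℕ => (y.1.1.1.1.1, y.2) :: y.1.2.1 :=
    list_cons.comp ((fst.comp (fst.comp (fst.comp (fst.comp fst)))).pair snd)
      (fst.comp (snd.comp fst))
  have h5 : Primrec fun y : Y => y.2.1 :: y.1.1.1.2.map fun σ => (y.1.1.1.1, σ) :: y.2.1 :=
    list_cons.comp (fst.comp snd) (list_map (snd.comp (fst.comp (fst.comp fst))) h4.to₂)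
  have h6 : Primrec fun y : Y =>
      (y.2.1 :: y.1.1.1.2.map fun σ => (y.1.1.1.1, σ) :: y.2.1).flatMap fun c' =>
        (gaps y.1.1.1.1 y.1.1.1.2 y.1.1.2).flatMap fun v =>
          y.2.2.map fun w' => c' :: (v ++ w') :=
    list_flatMap h5 h3.to₂
  refine (list_foldr (snd (α := (ℕ × List (List ℕ)) × ℕ)) (const [[]]) h6.to₂).of_eq fun x => ?_
  obtain ⟨x, w⟩ := x
  induction w with
  | nil => rfl
  | cons c w ih => simp only [insertions, List.foldr_cons, ← ih]

theorem primrec_letters : Primrec₂ letters := by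
  have h : PrimrecRel fun (e : ℕ × List ℕ) (π : ℕ) => e.1 = π :=
    Primrec.eq.comp (fst.comp fst) snd
  have h := (PrimrecRel.listFilter h).comp (list_flatten.comp snd) (fst (α := ℕ)
    (β := List Column))
  exact list_map h (snd.comp snd).to₂

/-! ### Primitive recursive evaluation of automata -/

theorem primrec_numLoc : Primrec fun C : AutomatonCode => C.1 := fst

theorem primrec_start : Primrec fun C : AutomatonCode => C.2.2.1 := fst.comp (snd.comp snd)

theorem primrec_trans : Primrec fun C : AutomatonCode => C.2.2.2.1 :=
  fst.comp (snd.comp (snd.comp snd))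

theorem primrec_accept : Primrec fun C : AutomatonCode => C.2.2.2.2 :=
  snd.comp (snd.comp (snd.comp snd))

theorem primrec_letter : Primrec fun e : TransitionCode => e.2.1 := fst.comp snd

theorem primrec_dst : Primrec fun e : TransitionCode => e.2.2.2.2 :=
  snd.comp (snd.comp (snd.comp snd))

/-- The sources of the transitions with letter `l` and target in `S`. -/
def predecessors (t : List TransitionCode) (l S : List ℕ) : List ℕ :=
  (t.filter fun e => e.2.1 = l ∧ e.2.2.2.2 ∈ S).map Prod.fst

theorem primrec_predecessors :
    Primrec₂ fun (t : List TransitionCode) (x : List ℕ × List ℕ) => predecessors t x.1 x.2 := by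
  have h : PrimrecRel fun (e : TransitionCode) (x : List ℕ × List ℕ) =>
      e.2.1 = x.1 ∧ e.2.2.2.2 ∈ x.2 :=
    (Primrec.eq.comp (primrec_letter.comp fst) (fst.comp snd)).and
      (primrecRel_mem.comp (snd.comp snd) (primrec_dst.comp fst))
  exact list_map h.listFilter (fst.comp snd).to₂

/-- The locations from which the automaton with code `C` has an accepting run on `u`. -/
def acceptingLocs (C : AutomatonCode) (u : List (List ℕ)) : List ℕ :=
  u.foldr (fun l S => predecessors C.2.2.2.1 l S) C.2.2.2.2

theorem primrec_acceptingLocs : Primrec₂ acceptingLocs := by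
  have h : Primrec₂ fun (x : AutomatonCode × List (List ℕ)) (y : List ℕ × List ℕ) =>
      predecessors x.1.2.2.2.1 y.1 y.2 :=
    primrec_predecessors.comp (primrec_trans.comp (fst.comp fst)) snd
  exact (list_foldr snd (primrec_accept.comp fst) h).of_eq fun _ => rfl

/-- The locations are computed backwards from the accepting ones, which matches the recursion of
`CodeRun` on the front of the word. -/
theorem TimedAutomaton.mem_acceptingLocs {n : ℕ} (A : TimedAutomaton (Letter n))
    (s : Fin A.numLoc) (u : List (List ℕ)) :
    s.val ∈ acceptingLocs A.code u ↔ A.CodeRun s u := by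
  induction u generalizing s with
  | nil => exact mem_finsetCode
  | cons l u ih =>
    have h : acceptingLocs A.code (l :: u) = ((A.trans.map Transition.code).filter fun e =>
      e.2.1 = l ∧ e.2.2.2.2 ∈ acceptingLocs A.code u).map Prod.fst := rfl
    simp only [h, List.mem_map, List.mem_filter, decide_eq_true_eq, TimedAutomaton.CodeRun, ← ih]
    constructor
    · rintro ⟨_, ⟨⟨e, he, rfl⟩, hl, hd⟩, hs⟩
      exact ⟨e, he, Fin.ext hs, hl, hd⟩
    · rintro ⟨e, he, rfl, hl, hd⟩
      exact ⟨_, ⟨⟨e, he, rfl⟩, hl, hd⟩, rfl⟩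

/-- The letters that occur in transitions. -/
def AutomatonCode.alphabet (C : AutomatonCode) : List (List ℕ) :=
  C.2.2.2.1.map fun e => e.2.1

theorem primrec_alphabet : Primrec AutomatonCode.alphabet :=
  list_map primrec_trans (primrec_letter.comp snd).to₂

/-! ### The bound for the search -/

theorem primrec_two_pow : Primrec fun m : ℕ => 2 ^ m := by
  refine (nat_rec₁ 1 (nat_mul.comp snd (const 2)).to₂).of_eq fun m => ?_
  induction m with
  | zero => rfl
  | succ m ih => rw [pow_succ, ← ih]

theorem primrec_sideBound : Primrec sideBound := by
  have h : Primrec fun x : ℕ × ℕ => x.2 * x.2 := nat_mul.comp snd snd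
  refine (nat_rec₁ 1 (nat_mul.comp h (primrec_two_pow.comp h)).to₂).of_eq fun m => ?_
  induction m with
  | zero => rfl
  | succ m ih => simp only [sideBound, ← ih]

theorem primrec_stateBound :
    Primrec fun x : (ℕ × ℕ) × List (Bool × ℕ) => stateBound x.1.1 x.2 x.1.2 := by
  have h : Primrec fun x : ((ℕ × ℕ) × List (Bool × ℕ)) × ((Bool × ℕ) × ℕ) =>
      2 ^ (2 ^ x.1.1.1 * x.2.2) :=
    primrec_two_pow.comp (nat_mul.comp (primrec_two_pow.comp (fst.comp (fst.comp fst)))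
      (snd.comp snd))
  have h0 : Primrec fun x : (ℕ × ℕ) × List (Bool × ℕ) => 2 ^ sideBound x.1.2 + 1 :=
    nat_add.comp (primrec_two_pow.comp (primrec_sideBound.comp (snd.comp fst))) (const 1)
  refine (list_foldr snd h0 h.to₂).of_eq fun x => ?_
  obtain ⟨x, l⟩ := x
  induction l with
  | nil => rfl
  | cons q l ih => simp only [stateBound, List.foldr_cons, ← ih]

/-! ### The decision procedure -/

/-- The bound for the search for a quantifier that is followed by the prefix `l`, with
quantifier-free part `m`. -/
def searchBound (C : AutomatonCode) (m : ℕ) (l : List (Bool × ℕ)) : ℕ :=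
  2 ^ C.1 * stateBound C.1 l m

theorem primrec_searchBound :
    Primrec₂ fun (x : AutomatonCode × ℕ) (l : List (Bool × ℕ)) => searchBound x.1 x.2 l := by
  have hk : Primrec fun x : (AutomatonCode × ℕ) × List (Bool × ℕ) => x.1.1.1 :=
    primrec_numLoc.comp (fst.comp fst)
  exact (nat_mul.comp (primrec_two_pow.comp hk)
    (primrec_stateBound.comp ((hk.pair (snd.comp fst)).pair snd))).of_eq fun _ => rfl

/-- The insertions into `w` for which the automaton accepts the letters of `π`. -/
def acceptedInsertions (C : AutomatonCode) (π B : ℕ) (w : List Column) : List (List Column) :=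
  (insertions π C.alphabet B w).filter fun z => C.2.2.1 ∈ acceptingLocs C (letters π z)

theorem primrec_acceptedInsertions :
    Primrec fun x : (AutomatonCode × ℕ) × (ℕ × List Column) =>
      acceptedInsertions x.1.1 x.1.2 x.2.1 x.2.2 := by
  have hi : Primrec fun x : (AutomatonCode × ℕ) × (ℕ × List Column) =>
      insertions x.1.2 x.1.1.alphabet x.2.1 x.2.2 :=
    (primrec_insertions.comp
      ((((snd.comp fst).pair (primrec_alphabet.comp (fst.comp fst))).pair (fst.comp snd)).pair
        (snd.comp snd))).of_eq fun _ => rfl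
  have hp : PrimrecRel fun (z : List Column) (x : AutomatonCode × ℕ) =>
      x.1.2.2.1 ∈ acceptingLocs x.1 (letters x.2 z) :=
    primrecRel_mem.comp
      (primrec_acceptingLocs.comp (fst.comp snd) (primrec_letters.comp (snd.comp snd) fst))
      (primrec_start.comp (fst.comp snd))
  exact (hp.listFilter.comp hi fst).of_eq fun _ => rfl

/-- The words to be considered for a quantifier over `π`, where `l` is the remaining prefix and
`x` consists of the automaton and the quantifier-free part. -/
def candidates (x : AutomatonCode × ℕ) (π : ℕ) (l : List (Bool × ℕ)) (w : List Column) :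
    List (List Column) :=
  acceptedInsertions x.1 π (searchBound x.1 x.2 l) w

theorem primrec_candidates :
    Primrec fun x : (AutomatonCode × ℕ) × (ℕ × (List (Bool × ℕ) × List Column)) =>
      candidates x.1 x.2.1 x.2.2.1 x.2.2.2 :=
  (primrec_acceptedInsertions.comp (((fst.comp fst).pair (fst.comp snd)).pair
    ((primrec_searchBound.comp fst (fst.comp (snd.comp snd))).pair
      (snd.comp (snd.comp snd))))).of_eq fun _ => rfl

/-- Combine the results for the candidates of a quantifier. -/
def combine (q : Bool) (r : List Bool) : Bool :=
  if q = true then decide (true ∈ r) else decide (¬ false ∈ r)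

theorem combine_true {r : List Bool} : combine true r = true ↔ true ∈ r := by simp [combine]

theorem combine_false {r : List Bool} : combine false r = true ↔ false ∉ r := by simp [combine]

theorem primrec_combine : Primrec₂ combine :=
  Primrec.ite (Primrec.eq.comp fst (const true)) (primrecRel_mem.comp snd (const true)).decide
    (primrecRel_mem.comp snd (const false)).not.decide

/-- Evaluate the formula with quantifier prefix `p.1` and quantifier-free part `x.2` on the word of
columns `p.2` for the automaton with code `x.1`. -/
noncomputable def evalPrefix (x : AutomatonCode × ℕ) : List (Bool × ℕ) → List Column → Bool
  | [], w => decide (0 ∈ (evalCode w x.2).1)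
  | q :: l, w => combine q.1 ((candidates x q.2 l w).map fun z => evalPrefix x l z)

/-- The recursive calls branch over a computed list and change the word, so plain recursion on the
prefix does not apply. `nat_omega_rec` does, with the length of the prefix as measure: `hl` lists
the calls to be made, `hg` combines their results. -/
theorem primrec_evalPrefix :
    Primrec₂ fun (x : AutomatonCode × ℕ) (p : List (Bool × ℕ) × List Column) =>
      evalPrefix x p.1 p.2 := by
  have hl : Primrec₂ fun (x : AutomatonCode × ℕ) (p : List (Bool × ℕ) × List Column) =>
      List.casesOn (motive := fun _ => List (List (Bool × ℕ) × List Column)) p.1 []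
        fun q l => (candidates x q.2 l p.2).map fun z => (l, z) := by
    let X := (AutomatonCode × ℕ) × (List (Bool × ℕ) × List Column)
    have h : Primrec fun y : X × ((Bool × ℕ) × List (Bool × ℕ)) =>
        candidates y.1.1 y.2.1.2 y.2.2 y.1.2.2 :=
      (primrec_candidates.comp ((fst.comp fst).pair ((snd.comp (fst.comp snd)).pair
        ((snd.comp snd).pair (snd.comp (snd.comp fst)))))).of_eq fun _ => rfl
    have h' : Primrec fun y : X × ((Bool × ℕ) × List (Bool × ℕ)) =>
        (candidates y.1.1 y.2.1.2 y.2.2 y.1.2.2).map fun z => (y.2.2, z) :=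
      list_map h ((snd.comp (snd.comp fst)).pair snd).to₂
    exact (list_casesOn (f := fun y : X => y.2.1) (fst.comp snd) (const []) h'.to₂).of_eq
      fun _ => rfl
  have hg : Primrec₂ fun (x : AutomatonCode × ℕ)
      (p : (List (Bool × ℕ) × List Column) × List Bool) =>
      some (List.casesOn (motive := fun _ => Bool) p.1.1 (decide (0 ∈ (evalCode p.1.2 x.2).1))
        fun q _ => combine q.1 p.2) := by
    let X := (AutomatonCode × ℕ) × ((List (Bool × ℕ) × List Column) × List Bool)
    have h0 : Primrec fun y : X => decide (0 ∈ (evalCode y.2.1.2 y.1.2).1) :=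
      (primrecRel_mem.comp (fst.comp (primrec_evalCode.comp (snd.comp (fst.comp snd))
        (snd.comp fst))) (const 0)).decide
    have h1 : Primrec fun y : X × ((Bool × ℕ) × List (Bool × ℕ)) => combine y.2.1.1 y.1.2.2 :=
      primrec_combine.comp (fst.comp (fst.comp snd)) (snd.comp (snd.comp fst))
    exact (option_some.comp (list_casesOn (f := fun y : X => y.2.1.1) (fst.comp (fst.comp snd)) h0
      h1.to₂)).of_eq fun _ => rfl
  refine nat_omega_rec _ (m := fun _ p => p.1.length) (list_length.comp (fst.comp snd)).to₂ hl hg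
    ?_ ?_
  · rintro x ⟨l, w⟩ b hb
    cases l with
    | nil => simp at hb
    | cons q l =>
      obtain ⟨z, -, rfl⟩ := List.mem_map.1 hb
      simp
  · rintro x ⟨l, w⟩
    cases l with
    | nil => rfl
    | cons q l => simp [evalPrefix, Function.comp_def]

end Primrec

/-- The bound used by `candidates` is the one in `HyperMTL.holds_ex_iff` and
`HyperMTL.holds_all_iff`, so the finite search is exact. -/
theorem evalPrefix_eq_true_iff {n : ℕ} (A : TimedAutomaton (Letter n)) (φ : HyperMTL n)
    (w : List Column) :
    evalPrefix (A.code, φ.code.2) φ.code.1 w = true ↔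
      φ.Holds A (AutomatonCode.alphabet A.code) w := by
  have hacc : ∀ (π : ℕ) (z : List Column), A.code.2.2.1 ∈ acceptingLocs A.code (letters π z) ↔
      A.CodeRun A.start (letters π z) := fun π z => A.mem_acceptingLocs _ _
  have hcand : ∀ (π : ℕ) (φ : HyperMTL n) (w z : List Column),
      z ∈ candidates (A.code, φ.code.2) π φ.code.1 w ↔
      z ∈ insertions π (AutomatonCode.alphabet A.code)
        (2 ^ A.numLoc * stateBound A.numLoc φ.code.1 φ.code.2) w ∧
      A.CodeRun A.start (letters π z) := by
    intro π φ w z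
    rw [← hacc]
    simp only [candidates, acceptedInsertions, List.mem_filter, decide_eq_true_eq]
    rfl
  induction φ generalizing w with
  | ex π φ ih =>
    rw [HyperMTL.holds_ex_iff]
    refine combine_true.trans ?_
    simp only [List.mem_map, ← ih, ← and_assoc, ← hcand]
    rfl
  | all π φ ih =>
    rw [HyperMTL.holds_all_iff]
    refine combine_false.trans ?_
    simp only [List.mem_map, ← ih, ← and_imp, ← hcand]
    simp only [not_exists, not_and, Bool.not_eq_false]
    rfl
  | qfree ψ =>
    simp only [HyperMTL.code, evalPrefix, decide_eq_true_eq, HyperMTL.Holds]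
    cases w with
    | nil => simp [mem_evalCode_fst]
    | cons c w => simp [(evalCode_spec (c :: w) ψ (i := 0) (by simp)).1]

/-! ### Trace assignments as words of columns -/

theorem Interval.IsTrivial.mem {I : Interval} (h : I.IsTrivial) (d : ℝ≥0) : I.Mem d := by
  obtain ⟨h1, h2, h3⟩ := h
  simp [Interval.Mem, h1, h2, h3]

/-- The events of the traces in `P` are those in the columns of `w`, where column `i` is at time
`τ i`. -/
structure Assignment.At {n : ℕ} (P : Assignment n) (w : List Column) (τ : ℕ → ℝ≥0) : Prop where
  lt_iff : ∀ {i j}, i < w.length → j < w.length → (τ i < τ j ↔ i < j)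
  entry_iff : ∀ {i}, i < w.length → ∀ π l, (π, l) ∈ w.getD i [] ↔
    ∃ ρ ∈ P π, ∃ σ, (σ, τ i) ∈ ρ.events ∧ finsetCode σ = l
  exists_eq : ∀ {t}, P.HasTime t → ∃ i < w.length, τ i = t

theorem Assignment.At.hasTime_iff {n : ℕ} {P : Assignment n} {w : List Column} {τ : ℕ → ℝ≥0}
    (h : P.At w τ) {i : ℕ} (hi : i < w.length) : P.HasTime (τ i) ↔ w.getD i [] ≠ [] := by
  have hne : w.getD i [] ≠ [] ↔ ∃ e, e ∈ w.getD i [] :=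
    ⟨List.exists_mem_of_ne_nil _, fun ⟨_, he⟩ => List.ne_nil_of_mem he⟩
  rw [hne]
  constructor
  · rintro ⟨π, ρ, hρ, σ, hσ⟩
    exact ⟨(π, finsetCode σ), (h.entry_iff hi _ _).2 ⟨ρ, hρ, σ, hσ, rfl⟩⟩
  · rintro ⟨⟨π, l⟩, hl⟩
    obtain ⟨ρ, hρ, σ, hσ, -⟩ := (h.entry_iff hi _ _).1 hl
    exact ⟨π, ρ, hρ, σ, hσ⟩

/-- The temporal operators look only at times with an event, and these are the times of the nonempty
columns (`hfwd`, `hbwd`). As `τ` preserves and reflects the order, times and positions can be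
exchanged. -/
theorem Assignment.At.sat_iff {n : ℕ} {P : Assignment n} {w : List Column} {τ : ℕ → ℝ≥0}
    (h : P.At w τ) (ψ : QFree n) (hψ : ψ.Untimed) (s : Bool) {i : ℕ} (hi : i < w.length) :
    (ψ.nnf s).Sat P (τ i) ↔ (ψ.nnf s).Holds w i := by
  have len : ∀ {j}, w.getD j [] ≠ [] → j < w.length := lt_length_of_getD_ne_nil
  have hfwd : ∀ {j}, w.getD j [] ≠ [] → P.HasTime (τ j) := fun hj => (h.hasTime_iff (len hj)).2 hj
  have hbwd : ∀ {t}, P.HasTime t → ∃ j, w.getD j [] ≠ [] ∧ τ j = t := by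
    intro t ht
    obtain ⟨j, hj, rfl⟩ := h.exists_eq ht
    exact ⟨j, (h.hasTime_iff hj).1 ht, rfl⟩
  induction ψ generalizing s i with
  | top =>
    cases s
    · exact (not_congr (h.hasTime_iff hi)).trans not_not
    · exact h.hasTime_iff hi
  | topOf π =>
    have key : (∃ ρ ∈ P π, ρ.HasTime (τ i)) ↔ ∃ l, (π, l) ∈ w.getD i [] := by
      simp only [h.entry_iff hi]
      constructor
      · rintro ⟨ρ, hρ, σ, hσ⟩
        exact ⟨_, ρ, hρ, σ, hσ, rfl⟩
      · rintro ⟨_, ρ, hρ, σ, hσ, rfl⟩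
        exact ⟨ρ, hρ, σ, hσ⟩
    cases s
    · exact not_congr key
    · exact key
  | prop p π =>
    cases s
    all_goals
      simp only [QFree.nnf, NNF.Sat, NNF.Holds, h.entry_iff hi]
      constructor
      · rintro ⟨ρ, hρ, σ, hσ, hp⟩
        exact ⟨_, ⟨ρ, hρ, σ, hσ, rfl⟩, by simpa [mem_finsetCode] using hp⟩
      · rintro ⟨_, ⟨ρ, hρ, σ, hσ, rfl⟩, hp⟩
        exact ⟨ρ, hρ, σ, hσ, by simpa [mem_finsetCode] using hp⟩
  | and a b iha ihb =>
    cases s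
    · exact or_congr (iha hψ.1 _ hi) (ihb hψ.2 _ hi)
    · exact and_congr (iha hψ.1 _ hi) (ihb hψ.2 _ hi)
  | neg a ih =>
    cases s
    · exact ih hψ _ hi
    · exact ih hψ _ hi
  | untl I a b iha ihb =>
    obtain ⟨hI, ha, hb⟩ := hψ
    cases s
    · simp only [QFree.nnf, NNF.Sat, NNF.Holds, hI.mem, true_implies]
      constructor
      · intro H j hij hj
        refine (H (τ j) ((h.lt_iff hi (len hj)).2 hij) (hfwd hj)).imp (ihb hb _ (len hj)).1 ?_
        rintro ⟨t, h1, h2, h3, h4⟩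
        obtain ⟨k, hk, rfl⟩ := hbwd h3
        exact ⟨k, (h.lt_iff hi (len hk)).1 h1, (h.lt_iff (len hk) (len hj)).1 h2, hk,
          (iha ha _ (len hk)).1 h4⟩
      · intro H t h1 ht
        obtain ⟨j, hj, rfl⟩ := hbwd ht
        refine (H j ((h.lt_iff hi (len hj)).1 h1) hj).imp (ihb hb _ (len hj)).2 ?_
        rintro ⟨k, h1, h2, hk, h4⟩
        exact ⟨τ k, (h.lt_iff hi (len hk)).2 h1, (h.lt_iff (len hk) (len hj)).2 h2, hfwd hk,
          (iha ha _ (len hk)).2 h4⟩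
    · simp only [QFree.nnf, NNF.Sat, NNF.Holds, hI.mem, true_and]
      constructor
      · rintro ⟨t, h1, ht, h2, h3⟩
        obtain ⟨j, hj, rfl⟩ := hbwd ht
        refine ⟨j, (h.lt_iff hi (len hj)).1 h1, hj, (ihb hb _ (len hj)).1 h2, fun k h4 h5 hk => ?_⟩
        exact (iha ha _ (len hk)).1 (h3 _ ((h.lt_iff hi (len hk)).2 h4)
          ((h.lt_iff (len hk) (len hj)).2 h5) (hfwd hk))
      · rintro ⟨j, h1, hj, h2, h3⟩
        refine ⟨τ j, (h.lt_iff hi (len hj)).2 h1, hfwd hj, (ihb hb _ (len hj)).2 h2,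
          fun t h4 h5 ht => ?_⟩
        obtain ⟨k, hk, rfl⟩ := hbwd ht
        exact (iha ha _ (len hk)).2 (h3 _ ((h.lt_iff hi (len hk)).1 h4)
          ((h.lt_iff (len hk) (len hj)).1 h5) hk)
  | snce I a b iha ihb =>
    obtain ⟨hI, ha, hb⟩ := hψ
    cases s
    · simp only [QFree.nnf, NNF.Sat, NNF.Holds, hI.mem, true_implies]
      constructor
      · intro H j hij hj
        refine (H (τ j) ((h.lt_iff (len hj) hi).2 hij) (hfwd hj)).imp (ihb hb _ (len hj)).1 ?_
        rintro ⟨t, h1, h2, h3, h4⟩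
        obtain ⟨k, hk, rfl⟩ := hbwd h3
        exact ⟨k, (h.lt_iff (len hj) (len hk)).1 h1, (h.lt_iff (len hk) hi).1 h2, hk,
          (iha ha _ (len hk)).1 h4⟩
      · intro H t h1 ht
        obtain ⟨j, hj, rfl⟩ := hbwd ht
        refine (H j ((h.lt_iff (len hj) hi).1 h1) hj).imp (ihb hb _ (len hj)).2 ?_
        rintro ⟨k, h1, h2, hk, h4⟩
        exact ⟨τ k, (h.lt_iff (len hj) (len hk)).2 h1, (h.lt_iff (len hk) hi).2 h2, hfwd hk,
          (iha ha _ (len hk)).2 h4⟩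
    · simp only [QFree.nnf, NNF.Sat, NNF.Holds, hI.mem, true_and]
      constructor
      · rintro ⟨t, h1, ht, h2, h3⟩
        obtain ⟨j, hj, rfl⟩ := hbwd ht
        refine ⟨j, (h.lt_iff (len hj) hi).1 h1, hj, (ihb hb _ (len hj)).1 h2, fun k h4 h5 hk => ?_⟩
        exact (iha ha _ (len hk)).1 (h3 _ ((h.lt_iff (len hj) (len hk)).2 h4)
          ((h.lt_iff (len hk) hi).2 h5) (hfwd hk))
      · rintro ⟨j, h1, hj, h2, h3⟩
        refine ⟨τ j, (h.lt_iff (len hj) hi).2 h1, hfwd hj, (ihb hb _ (len hj)).2 h2,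
          fun t h4 h5 ht => ?_⟩
        obtain ⟨k, hk, rfl⟩ := hbwd ht
        exact (iha ha _ (len hk)).2 (h3 _ ((h.lt_iff (len hj) (len hk)).1 h4)
          ((h.lt_iff (len hk) hi).1 h5) hk)

/-! ### Timed words of columns -/

/-- Columns with timestamps. -/
abbrev TimedColumns : Type := List (Column × ℝ≥0)

/-- Timestamps are strictly increasing. -/
def Increasing {α : Type} (Z : List (α × ℝ≥0)) : Prop :=
  Z.Pairwise fun x y => x.2 < y.2

theorem Increasing.of_sublist {α β : Type} {Z : List (α × ℝ≥0)} {Y : List (β × ℝ≥0)}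
    (hY : Increasing Y) (h : (Z.map Prod.snd).Sublist (Y.map Prod.snd)) : Increasing Z :=
  List.pairwise_map.1 ((List.pairwise_map.2 hY).sublist h)

/-- `e` is an entry of a column at time `t`. -/
def TimedColumns.HasEntry (Z : TimedColumns) (t : ℝ≥0) (e : ℕ × List ℕ) : Prop :=
  ∃ c, (c, t) ∈ Z ∧ e ∈ c

theorem TimedColumns.hasEntry_cons {Z : TimedColumns} {c : Column} {s t : ℝ≥0}
    {e : ℕ × List ℕ} :
    TimedColumns.HasEntry ((c, s) :: Z) t e ↔ (t = s ∧ e ∈ c) ∨ TimedColumns.HasEntry Z t e := by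
  simp only [TimedColumns.HasEntry, List.mem_cons, Prod.mk.injEq]
  constructor
  · rintro ⟨d, ⟨rfl, rfl⟩ | hd, he⟩
    · exact Or.inl ⟨rfl, he⟩
    · exact Or.inr ⟨d, hd, he⟩
  · rintro (⟨rfl, he⟩ | ⟨d, hd, he⟩)
    · exact ⟨c, Or.inl ⟨rfl, rfl⟩, he⟩
    · exact ⟨d, Or.inr hd, he⟩

/-- The columns `Z`, the first one at time `0`, contain exactly the events of the traces in
`P`. -/
structure Assignment.Represents {n : ℕ} (P : Assignment n) (Z : TimedColumns) : Prop where
  increasing : Increasing Z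
  head : ∃ c Z₀, Z = (c, 0) :: Z₀
  hasEntry_iff : ∀ t π l, Z.HasEntry t (π, l) ↔
    ∃ ρ ∈ P π, ∃ σ, (σ, t) ∈ ρ.events ∧ finsetCode σ = l

theorem Assignment.Represents.sat_iff {n : ℕ} {P : Assignment n} {Z : TimedColumns}
    (h : P.Represents Z) (ψ : QFree n) (hψ : ψ.Untimed) :
    (ψ.nnf true).Sat P 0 ↔ (ψ.nnf true).Holds (Z.map Prod.fst) 0 := by
  have hget : ∀ {i} (hi : i < Z.length), (Z.map Prod.snd).getD i 0 = Z[i].2 := by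
    intro i hi
    rw [List.getD_eq_getElem _ _ (by simpa using hi), List.getElem_map]
  have hget' : ∀ {i} (hi : i < Z.length), (Z.map Prod.fst).getD i [] = Z[i].1 := by
    intro i hi
    rw [List.getD_eq_getElem _ _ (by simpa using hi), List.getElem_map]
  have hmono : ∀ {i j} (_ : i < j) (hj : j < Z.length), Z[i].2 < Z[j].2 := by
    intro i j hij hj
    exact List.pairwise_iff_getElem.1 h.increasing i j _ _ hij
  have hat : P.At (Z.map Prod.fst) fun i => (Z.map Prod.snd).getD i 0 := by
    constructor
    · intro i j hi hj
      rw [List.length_map] at hi hj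
      simp only [hget hi, hget hj]
      refine ⟨fun hlt => ?_, fun hij => hmono hij hj⟩
      by_contra hij
      rcases (Nat.le_of_not_lt hij).eq_or_lt with rfl | hji
      · exact lt_irrefl _ hlt
      · exact lt_asymm hlt (hmono hji hi)
    · intro i hi π l
      rw [List.length_map] at hi
      rw [hget' hi, ← h.hasEntry_iff, hget hi]
      constructor
      · intro hl
        exact ⟨_, List.getElem_mem hi, hl⟩
      · rintro ⟨c, hc, hl⟩
        obtain ⟨j, hj, hjc⟩ := List.mem_iff_getElem.1 hc
        have : j = i := by
          by_contra hne
          have h2 : Z[j].2 = Z[i].2 := by rw [hjc]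
          rcases lt_or_gt_of_ne hne with hlt | hlt
          · exact (hmono hlt hi).ne h2
          · exact (hmono hlt hj).ne' h2
        subst this
        rwa [hjc]
    · rintro t ⟨π, ρ, hρ, σ, hσ⟩
      obtain ⟨c, hc, -⟩ := (h.hasEntry_iff t π _).2 ⟨ρ, hρ, σ, hσ, rfl⟩
      obtain ⟨j, hj, hjc⟩ := List.mem_iff_getElem.1 hc
      exact ⟨j, by simpa using hj, by simp only [hget hj, hjc]⟩
  obtain ⟨c, Z₀, rfl⟩ := h.head
  exact hat.sat_iff ψ hψ true (i := 0) (by simp)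

/-! ### Merging a trace into a timed word of columns -/

/-- The third list is obtained from the first one by adding the events in the second one as events
of `π`. -/
inductive Merge {n : ℕ} (π : ℕ) : TimedColumns → List (Letter n × ℝ≥0) → TimedColumns → Prop
  | nil : Merge π [] [] []
  | fresh (σ : Letter n) (t : ℝ≥0) {Z E Y} (h : Merge π Z E Y) :
      Merge π Z ((σ, t) :: E) (([(π, finsetCode σ)], t) :: Y)
  | keep (c : Column) (t : ℝ≥0) {Z E Y} (h : Merge π Z E Y) :
      Merge π ((c, t) :: Z) E ((c, t) :: Y)
  | update (c : Column) (t : ℝ≥0) (σ : Letter n) {Z E Y} (h : Merge π Z E Y) :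
      Merge π ((c, t) :: Z) ((σ, t) :: E) (((π, finsetCode σ) :: c, t) :: Y)

namespace Merge

variable {n : ℕ} {π : ℕ} {Z Y : TimedColumns} {E : List (Letter n × ℝ≥0)}

theorem hasEntry_iff (h : Merge π Z E Y) (t : ℝ≥0) (e : ℕ × List ℕ) :
    Y.HasEntry t e ↔ Z.HasEntry t e ∨ ∃ σ, (σ, t) ∈ E ∧ e = (π, finsetCode σ) := by
  induction h with
  | nil => simp [TimedColumns.HasEntry]
  | fresh σ s h ih =>
    simp only [TimedColumns.hasEntry_cons, ih, List.mem_cons, Prod.mk.injEq, List.not_mem_nil,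
      or_false]
    grind
  | keep c s h ih =>
    simp only [TimedColumns.hasEntry_cons, ih]
    grind
  | update c s σ h ih =>
    simp only [TimedColumns.hasEntry_cons, ih, List.mem_cons, Prod.mk.injEq]
    grind

theorem letters_eq (h : Merge π Z E Y) (hZ : ∀ z ∈ Z, ∀ e ∈ z.1, e.1 ≠ π) :
    letters π (Y.map Prod.fst) = E.map fun e => finsetCode e.1 := by
  induction h with
  | nil => rfl
  | fresh σ s h ih =>
    rw [List.map_cons, letters_cons, ih hZ]
    simp [letters]
  | keep c s h ih =>
    have hc : letters π [c] = [] := by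
      simpa [letters] using fun a l hl => hZ _ List.mem_cons_self _ hl
    rw [List.map_cons, letters_cons, ih fun z hz => hZ z (List.mem_cons_of_mem _ hz), hc,
      List.nil_append]
  | update c s σ h ih =>
    have hc : c.filter (fun e => e.1 = π) = [] := by
      simpa using fun a l hl => hZ _ List.mem_cons_self _ hl
    rw [List.map_cons, letters_cons, ih fun z hz => hZ z (List.mem_cons_of_mem _ hz)]
    simp [letters, hc]

theorem sublist (h : Merge π Z E Y) : (E.map Prod.snd).Sublist (Y.map Prod.snd) := by
  induction h with
  | nil => exact List.Sublist.slnil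
  | fresh σ s h ih => exact ih.cons_cons _
  | keep c s h ih => exact ih.cons _
  | update c s σ h ih => exact ih.cons_cons _

theorem exists_time_eq (h : Merge π Z E Y) {y : Column × ℝ≥0} (hy : y ∈ Y) :
    (∃ z ∈ Z, z.2 = y.2) ∨ ∃ e ∈ E, e.2 = y.2 := by
  induction h with
  | nil => simp at hy
  | fresh σ s h ih =>
    rcases List.mem_cons.1 hy with rfl | hy
    · exact Or.inr ⟨_, List.mem_cons_self, rfl⟩
    · exact (ih hy).imp id fun ⟨e, he, hey⟩ => ⟨e, List.mem_cons_of_mem _ he, hey⟩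
  | keep c s h ih =>
    rcases List.mem_cons.1 hy with rfl | hy
    · exact Or.inl ⟨_, List.mem_cons_self, rfl⟩
    · exact (ih hy).imp (fun ⟨z, hz, hzy⟩ => ⟨z, List.mem_cons_of_mem _ hz, hzy⟩) id
  | update c s σ h ih =>
    rcases List.mem_cons.1 hy with rfl | hy
    · exact Or.inl ⟨_, List.mem_cons_self, rfl⟩
    · exact (ih hy).imp (fun ⟨z, hz, hzy⟩ => ⟨z, List.mem_cons_of_mem _ hz, hzy⟩)
        fun ⟨e, he, hey⟩ => ⟨e, List.mem_cons_of_mem _ he, hey⟩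

/-- The block `v` of events before the first column of `Z` is split off because `Insertion` allows
no fresh column in front. When this is applied to the columns after time `0`, `v` becomes the block
following the column at `0`. -/
theorem exists_insertion (h : Merge π Z E Y) {alph : List (List ℕ)}
    (hE : ∀ e ∈ E, finsetCode e.1 ∈ alph) :
    ∃ v w, (∀ d ∈ v, IsFresh π alph d) ∧ Insertion π alph (Z.map Prod.fst) w ∧
      Y.map Prod.fst = v ++ w := by
  induction h with
  | nil => exact ⟨[], [], by simp, rfl, rfl⟩
  | fresh σ s h ih =>
    obtain ⟨v, w, hv, hw, hY⟩ := ih fun e he => hE e (List.mem_cons_of_mem _ he)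
    refine ⟨[(π, finsetCode σ)] :: v, w, ?_, hw, by simp [hY]⟩
    rintro d (_ | ⟨_, hd⟩)
    · exact ⟨_, hE _ List.mem_cons_self, rfl⟩
    · exact hv d hd
  | keep c s h ih =>
    obtain ⟨v, w, hv, hw, hY⟩ := ih hE
    exact ⟨[], c :: (v ++ w), by simp, ⟨c, v, w, Or.inl rfl, hv, hw, rfl⟩, by simp [hY]⟩
  | update c s σ h ih =>
    obtain ⟨v, w, hv, hw, hY⟩ := ih fun e he => hE e (List.mem_cons_of_mem _ he)
    exact ⟨[], ((π, finsetCode σ) :: c) :: (v ++ w), by simp,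
      ⟨_, v, w, Or.inr ⟨_, hE _ List.mem_cons_self, rfl⟩, hv, hw, rfl⟩, by simp [hY]⟩

theorem lt_of_forall_lt (h : Merge π Z E Y) {t : ℝ≥0} (hZ : ∀ z ∈ Z, t < z.2)
    (hE : ∀ e ∈ E, t < e.2) : ∀ y ∈ Y, t < y.2 := by
  intro y hy
  rcases h.exists_time_eq hy with ⟨z, hz, hzy⟩ | ⟨e, he, hey⟩
  · exact hzy ▸ hZ z hz
  · exact hey ▸ hE e he

/-- Merging of sorted lists: the earlier head goes first, and an event at the time of a column joins
that column. -/
theorem exists_of_increasing (Z : TimedColumns) (E : List (Letter n × ℝ≥0)) (hZ : Increasing Z)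
    (hE : Increasing E) : ∃ Y, Increasing Y ∧ Merge π Z E Y := by
  induction Z generalizing E with
  | nil =>
    clear hZ
    induction E with
    | nil => exact ⟨[], List.Pairwise.nil, .nil⟩
    | cons e E ih =>
      obtain ⟨h1, h2⟩ := List.pairwise_cons.1 hE
      obtain ⟨Y, hY, hm⟩ := ih h2
      exact ⟨_, List.pairwise_cons.2 ⟨hm.lt_of_forall_lt (by simp) h1, hY⟩, .fresh e.1 e.2 hm⟩
  | cons z Z ih =>
    obtain ⟨c, t⟩ := z
    obtain ⟨z1, z2⟩ := List.pairwise_cons.1 hZ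
    induction E with
    | nil =>
      obtain ⟨Y, hY, hm⟩ := ih [] z2 List.Pairwise.nil
      exact ⟨_, List.pairwise_cons.2 ⟨hm.lt_of_forall_lt z1 (by simp), hY⟩, .keep c t hm⟩
    | cons e E ihE =>
      obtain ⟨σ, s⟩ := e
      obtain ⟨e1, e2⟩ := List.pairwise_cons.1 hE
      rcases lt_trichotomy s t with hst | rfl | hst
      · obtain ⟨Y, hY, hm⟩ := ihE e2
        refine ⟨_, List.pairwise_cons.2 ⟨hm.lt_of_forall_lt ?_ e1, hY⟩, .fresh σ s hm⟩
        rintro z (_ | ⟨_, hz⟩)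
        · exact hst
        · exact hst.trans (z1 z hz)
      · obtain ⟨Y, hY, hm⟩ := ih E z2 e2
        exact ⟨((π, finsetCode σ) :: c, s) :: Y,
          List.pairwise_cons.2 ⟨hm.lt_of_forall_lt z1 e1, hY⟩, .update c s σ hm⟩
      · obtain ⟨Y, hY, hm⟩ := ih ((σ, s) :: E) z2 hE
        refine ⟨_, List.pairwise_cons.2 ⟨hm.lt_of_forall_lt z1 ?_, hY⟩, .keep c t hm⟩
        rintro e (_ | ⟨_, he⟩)
        · exact hst
        · exact hst.trans (e1 e he)

/-- Timestamps are chosen from left to right. Before a column of `Z` they exist by density, and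
after the last column one can always add `1`. The lower bound `t` is the last time already used. -/
theorem exists_of_insertion {alph : List (List ℕ)}
    (halph : ∀ l ∈ alph, ∃ σ : Letter n, finsetCode σ = l) (Z : TimedColumns) (hZ : Increasing Z)
    (v w : List Column) (hv : ∀ d ∈ v, IsFresh π alph d)
    (hw : Insertion π alph (Z.map Prod.fst) w) (t : ℝ≥0) (ht : ∀ z ∈ Z, t < z.2) :
    ∃ (E : List (Letter n × ℝ≥0)) (Y : TimedColumns), Merge π Z E Y ∧ Increasing Y ∧
      Y.map Prod.fst = v ++ w ∧ ∀ y ∈ Y, t < y.2 := by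
  induction Z generalizing v w t with
  | nil =>
    obtain rfl : w = [] := hw
    clear ht
    induction v generalizing t with
    | nil => exact ⟨[], [], .nil, List.Pairwise.nil, rfl, by simp⟩
    | cons d v ih =>
      obtain ⟨E, Y, hm, hY, hYv, hYt⟩ := ih (fun d hd => hv d (List.mem_cons_of_mem _ hd)) (t + 1)
      obtain ⟨l, hl, rfl⟩ := hv d List.mem_cons_self
      obtain ⟨σ, rfl⟩ := halph l hl
      have hlt : t < t + 1 := lt_add_of_pos_right t one_pos
      refine ⟨_, _, .fresh σ (t + 1) hm, List.pairwise_cons.2 ⟨hYt, hY⟩, by simp [hYv], ?_⟩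
      rintro y (_ | ⟨_, hy⟩)
      · exact hlt
      · exact hlt.trans (hYt y hy)
  | cons z Z ih =>
    obtain ⟨c, s⟩ := z
    obtain ⟨z1, z2⟩ := List.pairwise_cons.1 hZ
    obtain ⟨c', v', w', hc, hv', hw', rfl⟩ := hw
    induction v generalizing t with
    | nil =>
      obtain ⟨E, Y, hm, hY, hYv, hYt⟩ := ih z2 v' w' hv' hw' s z1
      have hts : t < s := ht _ List.mem_cons_self
      rcases hc with rfl | ⟨l, hl, rfl⟩
      · refine ⟨_, _, .keep c' s hm, List.pairwise_cons.2 ⟨hYt, hY⟩, by simp [hYv], ?_⟩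
        rintro y (_ | ⟨_, hy⟩)
        · exact hts
        · exact hts.trans (hYt y hy)
      · obtain ⟨σ, rfl⟩ := halph l hl
        refine ⟨_, _, .update c s σ hm, List.pairwise_cons.2 ⟨hYt, hY⟩, by simp [hYv], ?_⟩
        rintro y (_ | ⟨_, hy⟩)
        · exact hts
        · exact hts.trans (hYt y hy)
    | cons d v ihv =>
      obtain ⟨r, htr, hrs⟩ := exists_between (ht _ List.mem_cons_self)
      obtain ⟨E, Y, hm, hY, hYv, hYt⟩ := ihv (fun d hd => hv d (List.mem_cons_of_mem _ hd)) r (by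
        rintro z (_ | ⟨_, hz⟩)
        · exact hrs
        · exact hrs.trans (z1 z hz))
      obtain ⟨l, hl, rfl⟩ := hv d List.mem_cons_self
      obtain ⟨σ, rfl⟩ := halph l hl
      refine ⟨_, _, .fresh σ r hm, List.pairwise_cons.2 ⟨hYt, hY⟩, by simp [hYv], ?_⟩
      rintro y (_ | ⟨_, hy⟩)
      · exact htr
      · exact htr.trans (hYt y hy)

end Merge

/-! ### Quantifiers -/

/-- As `π` is unassigned, the update overwrites no trace whose events are already in the columns. -/
theorem Assignment.Represents.update {n : ℕ} {P : Assignment n} {Z : TimedColumns}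
    (h : P.Represents Z) {π : ℕ} (hπ : P π = none) {ρ : TimedWord (Letter n)} {Y : TimedColumns}
    (hm : Merge π Z ρ.events Y) (hY : Increasing Y) (hd : ∃ c Y₀, Y = (c, 0) :: Y₀) :
    Assignment.Represents (Function.update P π (some ρ)) Y := by
  refine ⟨hY, hd, fun t π' l => ?_⟩
  rw [hm.hasEntry_iff, h.hasEntry_iff]
  by_cases hne : π' = π
  · subst hne
    simp [hπ, eq_comm]
  · simp [hne]

theorem Assignment.Represents.ne_of_eq_none {n : ℕ} {P : Assignment n} {Z : TimedColumns}
    (h : P.Represents Z) {π : ℕ} (hπ : P π = none) : ∀ z ∈ Z, ∀ e ∈ z.1, e.1 ≠ π := by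
  rintro ⟨c, t⟩ hz ⟨π', l⟩ he rfl
  obtain ⟨ρ, hρ, -⟩ := (h.hasEntry_iff t π' l).1 ⟨c, hz, he⟩
  simp [hπ] at hρ

theorem Assignment.Represents.exists_insertion {n : ℕ} {P : Assignment n} {Z : TimedColumns}
    (h : P.Represents Z) {π : ℕ} (hπ : P π = none) {alph : List (List ℕ)}
    (ρ : TimedWord (Letter n)) (hρ : ∀ e ∈ ρ.events, finsetCode e.1 ∈ alph) :
    ∃ Y : TimedColumns, Insertion π alph (Z.map Prod.fst) (Y.map Prod.fst) ∧
      letters π (Y.map Prod.fst) = ρ.events.map (fun e => finsetCode e.1) ∧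
      Assignment.Represents (Function.update P π (some ρ)) Y := by
  obtain ⟨c, Z₀, rfl⟩ := h.head
  obtain ⟨z1, z2⟩ := List.pairwise_cons.1 h.increasing
  have hfresh := h.ne_of_eq_none hπ
  -- The column at time `0` must stay first: an event of `ρ` at `0` joins it, and otherwise all
  -- events of `ρ` come strictly later.
  by_cases h0 : ∃ σ E, ρ.events = (σ, 0) :: E
  · obtain ⟨σ, E, hE⟩ := h0
    obtain ⟨e1, e2⟩ := List.pairwise_cons.1 (hE ▸ ρ.increasing)
    obtain ⟨Y, hY, hm⟩ := Merge.exists_of_increasing (π := π) Z₀ E z2 e2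
    obtain ⟨v, w, hv, hw, hYw⟩ := hm.exists_insertion fun e he =>
      hρ e (hE ▸ List.mem_cons_of_mem _ he)
    have hm' : Merge π ((c, 0) :: Z₀) ρ.events (((π, finsetCode σ) :: c, 0) :: Y) :=
      hE ▸ hm.update c 0 σ
    refine ⟨_, ⟨_, v, w, Or.inr ⟨_, hρ (σ, 0) (by simp [hE]), rfl⟩, hv, hw, ?_⟩,
      hm'.letters_eq hfresh, h.update hπ hm'
        (List.pairwise_cons.2 ⟨hm.lt_of_forall_lt z1 e1, hY⟩) ⟨_, _, rfl⟩⟩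
    rw [List.map_cons, hYw]
  · obtain ⟨Y, hY, hm⟩ := Merge.exists_of_increasing (π := π) Z₀ ρ.events z2 ρ.increasing
    have hpos : ∀ e ∈ ρ.events, (0 : ℝ≥0) < e.2 := by
      intro e he
      have hinc := ρ.increasing
      cases hE : ρ.events with
      | nil => simp [hE] at he
      | cons e' E =>
        have he' : 0 < e'.2 := by
          by_contra hle
          exact h0 ⟨e'.1, E, by rw [hE, ← nonpos_iff_eq_zero.1 (not_lt.1 hle)]⟩
        rw [hE] at he hinc
        rcases List.mem_cons.1 he with rfl | he
        · exact he'
        · exact he'.trans ((List.pairwise_cons.1 hinc).1 e he)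
    obtain ⟨v, w, hv, hw, hYw⟩ := hm.exists_insertion hρ
    refine ⟨_, ⟨c, v, w, Or.inl rfl, hv, hw, ?_⟩, (hm.keep c 0).letters_eq hfresh,
      h.update hπ (hm.keep c 0)
        (List.pairwise_cons.2 ⟨hm.lt_of_forall_lt z1 hpos, hY⟩) ⟨_, _, rfl⟩⟩
    rw [List.map_cons, hYw]

theorem Assignment.Represents.exists_trace {n : ℕ} {P : Assignment n} {Z : TimedColumns}
    (h : P.Represents Z) {π : ℕ} (hπ : P π = none) {alph : List (List ℕ)}
    (halph : ∀ l ∈ alph, ∃ σ : Letter n, finsetCode σ = l) {z : List Column}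
    (hz : Insertion π alph (Z.map Prod.fst) z) :
    ∃ (ρ : TimedWord (Letter n)) (Y : TimedColumns), Y.map Prod.fst = z ∧
      letters π z = ρ.events.map (fun e => finsetCode e.1) ∧
      Assignment.Represents (Function.update P π (some ρ)) Y := by
  obtain ⟨c, Z₀, rfl⟩ := h.head
  obtain ⟨z1, z2⟩ := List.pairwise_cons.1 h.increasing
  have hfresh := h.ne_of_eq_none hπ
  obtain ⟨c', v, w, hc, hv, hw, rfl⟩ := hz
  obtain ⟨E, Y, hm, hY, hYw, hYt⟩ := Merge.exists_of_insertion halph Z₀ z2 v w hv hw 0 z1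
  have hcons : ∀ c', Increasing ((c', 0) :: Y) := fun c' => List.pairwise_cons.2 ⟨hYt, hY⟩
  have key : ∀ (c' : Column) (E' : List (Letter n × ℝ≥0)),
      Merge π ((c, 0) :: Z₀) E' ((c', 0) :: Y) →
      ∃ (ρ : TimedWord (Letter n)) (Y : TimedColumns), Y.map Prod.fst = c' :: (v ++ w) ∧
        letters π (c' :: (v ++ w)) = ρ.events.map (fun e => finsetCode e.1) ∧
        Assignment.Represents (Function.update P π (some ρ)) Y := by
    intro c' E' hm'
    have hYc : ((c', 0) :: Y).map Prod.fst = c' :: (v ++ w) := by rw [List.map_cons, hYw]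
    -- `E'` is a timed word because its timestamps form a sublist of those of the merged columns.
    exact ⟨⟨E', (hcons c').of_sublist hm'.sublist⟩, _, hYc, hYc ▸ hm'.letters_eq hfresh,
      h.update hπ hm' (hcons c') ⟨_, _, rfl⟩⟩
  rcases hc with rfl | ⟨l, hl, rfl⟩
  · exact key _ _ (hm.keep _ 0)
  · obtain ⟨σ, rfl⟩ := halph l hl
    exact key _ _ (hm.update c 0 σ)

/-- Accepted traces use only letters that occur in transitions, so inserting just these loses no
trace of the model. -/
theorem TimedAutomaton.CodeRun.mem_alphabet {n : ℕ} {A : TimedAutomaton (Letter n)}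
    {s : Fin A.numLoc} {u : List (List ℕ)} (h : A.CodeRun s u) :
    ∀ l ∈ u, l ∈ AutomatonCode.alphabet A.code := by
  induction u generalizing s with
  | nil => simp
  | cons l u ih =>
    obtain ⟨e, he, -, rfl, hr⟩ := h
    rintro l (_ | ⟨_, hl⟩)
    · exact List.mem_map.2 ⟨_, List.mem_map.2 ⟨e, he, rfl⟩, rfl⟩
    · exact ih hr l hl

theorem exists_letter_of_mem_alphabet {n : ℕ} {A : TimedAutomaton (Letter n)} {l : List ℕ}
    (hl : l ∈ AutomatonCode.alphabet A.code) : ∃ σ : Letter n, finsetCode σ = l := by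
  obtain ⟨_, he, rfl⟩ := List.mem_map.1 hl
  obtain ⟨e, -, rfl⟩ := List.mem_map.1 he
  exact ⟨e.letter, rfl⟩

/-- Traces of an untimed automaton correspond to insertions with accepted letters. -/
theorem Assignment.Represents.exists_trace_iff {n : ℕ} {A : TimedAutomaton (Letter n)}
    (hA : A.Untimed) {P : Assignment n} {Z : TimedColumns} (h : P.Represents Z) {π : ℕ}
    (hπ : P π = none) {S : Assignment n → Prop} {H : List Column → Prop}
    (hSH : ∀ (ρ : TimedWord (Letter n)) (Y : TimedColumns),
      Assignment.Represents (Function.update P π (some ρ)) Y →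
      (S (Function.update P π (some ρ)) ↔ H (Y.map Prod.fst))) :
    (∃ ρ ∈ A.language, S (Function.update P π (some ρ))) ↔
      ∃ z, Insertion π (AutomatonCode.alphabet A.code) (Z.map Prod.fst) z ∧
        A.CodeRun A.start (letters π z) ∧ H z := by
  constructor
  · rintro ⟨ρ, hρ, hS⟩
    have hrun := (hA.acceptsFrom_iff _ _ _ _).1 hρ
    obtain ⟨Y, h1, h2, h3⟩ := h.exists_insertion hπ ρ fun e he =>
      hrun.mem_alphabet _ (List.mem_map.2 ⟨e, he, rfl⟩)
    exact ⟨_, h1, h2 ▸ hrun, (hSH ρ Y h3).1 hS⟩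
  · rintro ⟨z, hz, hrun, hH⟩
    obtain ⟨ρ, Y, rfl, h2, h3⟩ :=
      h.exists_trace hπ (fun l hl => exists_letter_of_mem_alphabet hl) hz
    exact ⟨ρ, (hA.acceptsFrom_iff _ _ _ _).2 (h2 ▸ hrun), (hSH ρ Y h3).2 hH⟩

/-- Induction on the prefix. Since no variable is quantified twice, the variables still to be
quantified remain unassigned, as merging requires. -/
theorem Assignment.Represents.hyperMTL_sat_iff {n : ℕ} {A : TimedAutomaton (Letter n)}
    (hA : A.Untimed) (φ : HyperMTL n) (hφ : φ.Untimed) (hnd : φ.NoReuse) {P : Assignment n}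
    {Z : TimedColumns} (h : P.Represents Z) (hP : ∀ π ∈ φ.quantified, P π = none) :
    φ.Sat A.language P 0 ↔ φ.Holds A (AutomatonCode.alphabet A.code) (Z.map Prod.fst) := by
  induction φ generalizing P Z with
  | ex π φ ih =>
    obtain ⟨h1, h2⟩ := List.nodup_cons.1 hnd
    refine h.exists_trace_iff hA (hP π List.mem_cons_self) (S := fun P => φ.Sat A.language P 0)
      fun ρ Y hY => ih hφ h2 hY fun π' hπ' => ?_
    rw [Function.update_of_ne (by rintro rfl; exact h1 hπ')]
    exact hP π' (List.mem_cons_of_mem _ hπ')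
  | all π φ ih =>
    obtain ⟨h1, h2⟩ := List.nodup_cons.1 hnd
    have := h.exists_trace_iff hA (hP π List.mem_cons_self)
      (S := fun P => ¬ φ.Sat A.language P 0)
      (H := fun z => ¬ φ.Holds A (AutomatonCode.alphabet A.code) z)
      fun ρ Y hY => not_congr (ih hφ h2 hY fun π' hπ' => by
        rw [Function.update_of_ne (by rintro rfl; exact h1 hπ')]
        exact hP π' (List.mem_cons_of_mem _ hπ'))
    have := not_congr this
    push Not at this
    exact this
  | qfree ψ =>
    obtain ⟨c, Z₀, hZ⟩ := h.head
    refine (h.sat_iff ψ hφ).trans (iff_and_self.2 fun _ => ?_)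
    simp [hZ]

/-- The empty column stands for time `0`, where evaluation starts although no trace has an event
there yet. -/
theorem represents_empty {n : ℕ} : Assignment.Represents (n := n) (fun _ => none) [([], 0)] :=
  ⟨List.pairwise_singleton _ _, ⟨_, _, rfl⟩, fun t π l => by simp [TimedColumns.HasEntry]⟩

end TimedHyper

theorem mainTheorem7 :
    ∃ decider : ℕ × TimedHyper.AutomatonCode × TimedHyper.FormulaCode → Bool,
      Computable decider ∧
      ∀ (n : ℕ) (A : TimedHyper.TimedAutomaton (TimedHyper.Letter n)) (φ : TimedHyper.HyperMTL n),
        A.Untimed → φ.Untimed → φ.Closed → φ.NoReuse →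
          (decider (n, A.code, φ.code) = true ↔ TimedHyper.Satisfies A.language φ) := by
  refine ⟨fun x => TimedHyper.evalPrefix (x.2.1, x.2.2.2) x.2.2.1 [[]], ?_, ?_⟩
  · open Primrec in
    exact ((TimedHyper.primrec_evalPrefix.comp
      ((fst.comp snd).pair (snd.comp (snd.comp snd)))
      ((fst.comp (snd.comp snd)).pair (const [[]]))).of_eq fun _ => rfl).to_comp
  · intro n A φ hA hφ _ hnd
    refine (TimedHyper.evalPrefix_eq_true_iff A φ [[]]).trans ?_
    exact (TimedHyper.represents_empty.hyperMTL_sat_iff hA φ hφ hnd fun _ _ => rfl).symm
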